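/- **Theorem.** There is an absolute constant $C>0$ such that the following holds. Let $E$ be a finite set of elements and $(S)_{S\in\mathcal S}$ a finite family of subsets of $E$ whose indices (IDs) are linearly ordered. Let $s,t\ge 2$ be integers such that every set has at most $s$ elements and every element lies in at least one and at most $t$ sets, and let $\Lambda\ge\frac12\log_2(st)$ be real (for instance $\Lambda=\log_2(st)$ or $\Lambda=\log_2 s\cdot\log_2 t$). Then the algorithm below always returns a set cover $\mathcal S_{\mathrm{cvr}}$, and $\mathbb E\,|\mathcal S_{\mathrm{cvr}}|\le C\cdot\log_2 s\cdot \mathrm{OPT}$, where $\mathrm{OPT}$ is the optimal value of a fractional set cover, i.e. the minimum of $\sum_S x_S$ over $x\ge 0$ with $\sum_{S\ni e}x_S\ge1$ for all $e\in E$. *Algorithm.* For $1\le i\le\lceil\log_2 s\rceil$ and $1\le k\le L:=\lceil\log_2 t\rceil$, independently choose for each set $S$ a random subset $B_i(S)\subseteq S$ containing each element of $S$ independently with probability $p_i=\min(1,\Lambda^5\,2^i/s)$, and a random subfamily $\mathcal S_{i,k}\subseteq\mathcal S$ containing each set independently with probability $\min(1,2^k/t)$. The cover is initially empty. At any moment an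 element is *free* if it is neither covered by the current cover nor *pretends* to be covered (once it pretends, it does so until the final clean-up). In stage $i$ put $\hat d(S)=|\{e\in B_i(S): e\text{ free}\}|/p_i$ (with respect to the current state), and call $S$ *large* if $\hat d(S)\ge s/2^i$. Set $\log\log t := \log_2\log_2 t$. All additions within one step are simultaneous. For $i=1,\dots,\lceil\log_2 s\rceil$, stage $i$ does the following: 1. Add every set $S$ such that $B_i(S)$ contains at least $\Lambda^{10}$ elements that are free at the beginning of the stage. 2. For $k=1,\dots,L$ in order: let $\hat{\mathcal S}_k$ be the family of all currently large $S\in\mathcal S_{i,k}$; then every free element contained in at least $\Lambda^{10}\cdot2^{k}$ sets of $\hat{\mathcal S}_k$ pretends to be covered. 3. Run $\mathrm{RecSplit}(1,L,(\hat{\mathcal S}_1,\dots,\hat{\mathcal S}_L))$. $\mathrm{RecSplit}(k',R,(\hat{\mathcal S}_{k'},\dots,\hat{\mathcal S}_{k'+R-1}))$ is the following procedure. If $R\le\max(1,\log\log t)$, then for $k=k',\dots,k'+R-1$ in order, add all sets $S\in\hat{\mathcal S}_k$ that are not yet in the cover and are large at the beginning of iteration $k$. Otherwise let $h=\lfloor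 R/2\rfloor$ and: (a) run $\mathrm{RecSplit}(k',h,(\hat{\mathcal S}_{k'},\dots,\hat{\mathcal S}_{k'+h-1}))$; (b) for $k=k'+h,\dots,k'+R-1$ in order, let $\mathcal S'_k$ be the family of all currently large $S\in\hat{\mathcal S}_k$; then every free element contained in at least $\Lambda^{10}\cdot 2^{k-(k'+h)}$ sets of $\mathcal S'_k$ pretends to be covered; (c) run $\mathrm{RecSplit}(k'+h,R-h,(\mathcal S'_{k'+h},\dots,\mathcal S'_{k'+R-1}))$. After the last stage (clean-up), for each element not covered by the cover, add the set with smallest ID that contains it. Return the resulting family. -/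

import Mathlib

open MeasureTheory ProbabilityTheory

namespace RepeatedSparsification

/-- A set system together with the numerical parameters of the algorithm. The family of sets is
indexed by `ι` (the sets are the vertices on one side of a bipartite graph, with their index as
ID), and `A S` is the set of elements of `E` contained in the set `S`. The number `s` bounds the
sizes of the sets, `t` bounds the number of sets containing an element, and `Λ` is the logarithmic
quantity whose powers `Λ ^ 5` and `Λ ^ 10` are the sampling rate and the cutoff. -/
structure Input (ι E : Type*) where
  A : ι → Finset E
  s : ℕ
  t : ℕ
  Λ : ℝ

section

variable {ι E : Type*} [Fintype ι] [LinearOrder ι] [Fintype E] [DecidableEq E]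

/-- `X` is a set cover: every element lies in a set of `X`. -/
def IsSetCover (A : ι → Finset E) (X : Finset ι) : Prop :=
  ∀ e, ∃ S ∈ X, e ∈ A S

/-- `x` is a fractional set cover. -/
def IsFractionalCover (A : ι → Finset E) (x : ι → ℝ) : Prop :=
  (∀ S, 0 ≤ x S) ∧ ∀ e, 1 ≤ ∑ S with e ∈ A S, x S

/-- The value of an optimal fractional set cover. -/
noncomputable def opt (A : ι → Finset E) : ℝ :=
  sInf {v | ∃ x, IsFractionalCover A x ∧ v = ∑ S, x S}

/-- The number of sets of `X` containing the element `e`. -/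
def elemDegree (A : ι → Finset E) (X : Finset ι) (e : E) : ℕ :=
  {S ∈ X | e ∈ A S}.card

namespace Input

/-- The number `⌈log₂ s⌉` of stages. -/
def stages (I : Input ι E) : ℕ := Nat.clog 2 I.s

/-- The number `⌈log₂ t⌉` of iterations in each stage. -/
def iterations (I : Input ι E) : ℕ := Nat.clog 2 I.t

/-- The probability `p_i` with which an element of `S` is included in `B_i(S)`. -/
noncomputable def sampleProb (I : Input ι E) (i : ℕ) : ℝ :=
  min 1 (I.Λ ^ 5 * (2 ^ i / I.s))

/-- The probability with which a set is included in the family `S_{i,k}`. -/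
noncomputable def familyProb (I : Input ι E) (k : ℕ) : ℝ :=
  min 1 (2 ^ k / I.t)

end Input

/-- The random choices of the algorithm: `B i S` is the sampled subset `B_i(S)` of the set `S`, and
`F i k` is the sampled subfamily `S_{i,k}`. -/
structure Choices (ι E : Type*) where
  B : ℕ → ι → Finset E
  F : ℕ → ℕ → Finset ι

/-- The state of the algorithm: `cover` is the family of the sets added so far, and `free` is the
set of the elements that are neither covered nor pretend to be covered. -/
structure State (ι E : Type*) where
  cover : Finset ι
  free : Finset E

/-- Add all sets of `X` simultaneously to the cover. -/
def State.addSets (A : ι → Finset E) (st : State ι E) (X : Finset ι) : State ι E :=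
  ⟨st.cover ∪ X, st.free \ X.biUnion A⟩

/-- Let all elements of `Y` simultaneously pretend to be covered. -/
def State.pretend (st : State ι E) (Y : Finset E) : State ι E :=
  ⟨st.cover, st.free \ Y⟩

/-- The estimated number of free elements of `S` in stage `i`, in the current state. -/
noncomputable def estDegree (I : Input ι E) (c : Choices ι E) (i : ℕ) (st : State ι E) (S : ι) : ℝ :=
  ((c.B i S ∩ st.free).card : ℝ) / I.sampleProb i

/-- The estimated number of free elements of `S` is at least `s / 2 ^ i`. -/
def IsLarge (I : Input ι E) (c : Choices ι E) (i : ℕ) (st : State ι E) (S : ι) : Prop :=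
  (I.s : ℝ) / 2 ^ i ≤ estDegree I c i st S

open scoped Classical in
/-- One pass of the sparsification loop, for the iteration number `k`: the family `G k` is
restricted to the sets that are currently large, and then every free element contained in at least
`thr k` sets of the resulting family pretends to be covered. -/
noncomputable def sparsifyStep (I : Input ι E) (c : Choices ι E) (i : ℕ) (thr : ℕ → ℝ)
    (x : (ℕ → Finset ι) × State ι E) (k : ℕ) : (ℕ → Finset ι) × State ι E :=
  let G' : Finset ι := {S ∈ x.1 k | IsLarge I c i x.2 S}
  (Function.update x.1 k G',
    x.2.pretend {e ∈ x.2.free | thr k ≤ (elemDegree I.A G' e : ℝ)})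

/-- The sparsification loop `for each k ∈ {k₀, …, k₀ + n - 1}`. -/
noncomputable def sparsify (I : Input ι E) (c : Choices ι E) (i : ℕ) (thr : ℕ → ℝ) (k₀ n : ℕ)
    (G : ℕ → Finset ι) (st : State ι E) : (ℕ → Finset ι) × State ι E :=
  (List.range' k₀ n).foldl (sparsifyStep I c i thr) (G, st)

open scoped Classical in
/-- The procedure `BaseCase`: it executes the iterations `k₀, …, k₀ + R - 1` of stage `i`. -/
noncomputable def baseCase (I : Input ι E) (c : Choices ι E) (i k₀ R : ℕ)
    (G : ℕ → Finset ι) (st : State ι E) : State ι E :=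
  (List.range' k₀ R).foldl
    (fun st k => st.addSets I.A {S ∈ G k | S ∉ st.cover ∧ IsLarge I c i st S}) st

open scoped Classical in
/-- The recursive procedure `RecSplit`: it executes the iterations `k₀, …, k₀ + R - 1` of stage `i`
with the families `G k₀, …, G (k₀ + R - 1)`. It stops splitting once `R ≤ log log t`; a single
iteration cannot be split either. The set of elements that are free at the beginning of a call is
part of the state `st`. -/
noncomputable def recSplit (I : Input ι E) (c : Choices ι E) (i k₀ R : ℕ)
    (G : ℕ → Finset ι) (st : State ι E) : State ι E :=
  if _h : R ≤ 1 ∨ (R : ℝ) ≤ Real.logb 2 (Real.logb 2 I.t) then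
    baseCase I c i k₀ R G st
  else
    let st₁ := recSplit I c i k₀ (R / 2) G st
    let x := sparsify I c i (fun k => I.Λ ^ 10 * 2 ^ (k - (k₀ + R / 2)))
      (k₀ + R / 2) (R - R / 2) G st₁
    recSplit I c i (k₀ + R / 2) (R - R / 2) x.1 x.2
termination_by R
decreasing_by all_goals omega

open scoped Classical in
/-- Stage `i` of the algorithm: the sets with too many free sampled elements are added, the
families `S_{i,k}` are sparsified, and `RecSplit` executes all iterations. -/
noncomputable def stage (I : Input ι E) (c : Choices ι E) (st : State ι E) (i : ℕ) : State ι E :=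
  let st₁ := st.addSets I.A {S | I.Λ ^ 10 ≤ ((c.B i S ∩ st.free).card : ℝ)}
  let x := sparsify I c i (fun k => I.Λ ^ 10 * 2 ^ k) 1 I.iterations (c.F i) st₁
  recSplit I c i 1 I.iterations x.1 x.2

/-- The sets added at the end: for each element that is not covered by `X`, the set with smallest
ID that contains it. -/
def cleanUp (A : ι → Finset E) (X : Finset ι) : Finset ι :=
  {S | ∃ e, (∀ S' ∈ X, e ∉ A S') ∧ e ∈ A S ∧ ∀ S', e ∈ A S' → S ≤ S'}

/-- The family of sets returned by the algorithm, for given outcomes of the random choices. -/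
noncomputable def algorithm (I : Input ι E) (c : Choices ι E) : Finset ι :=
  let st := (List.range' 1 I.stages).foldl (stage I c) ⟨∅, Finset.univ⟩
  st.cover ∪ cleanUp I.A st.cover

/-- The random bits. There is one for each stage `i`, set `S` and element `e` (is `e` included in
`B_i(S)`?), and one for each stage `i`, iteration `k` and set `S` (is `S` included in
`S_{i,k}`?). -/
abbrev Coin (I : Input ι E) : Type _ :=
  (Finset.Icc 1 I.stages × ι × E) ⊕ (Finset.Icc 1 I.stages × Finset.Icc 1 I.iterations × ι)

/-- The probability that a random bit is `true`. -/
noncomputable def coinProb (I : Input ι E) : Coin I → ℝ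
  | .inl x => I.sampleProb x.1
  | .inr x => I.familyProb x.2.1

/-- The joint law of the random bits, which are independent; the clamping `Set.projIcc` to `[0, 1]`
does not change the probabilities, which lie in `[0, 1]`. -/
noncomputable def coinMeasure (I : Input ι E) : Measure (Coin I → Bool) :=
  Measure.pi fun x =>
    bernoulliMeasure true false (Set.projIcc (0 : ℝ) 1 zero_le_one (coinProb I x))

open scoped Classical in
/-- The random choices determined by the random bits. -/
noncomputable def choices (I : Input ι E) (ω : Coin I → Bool) : Choices ι E where
  B i S := {e ∈ I.A S | ∃ hi : i ∈ Finset.Icc 1 I.stages, ω (.inl (⟨i, hi⟩, S, e)) = true}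
  F i k := {S | ∃ (hi : i ∈ Finset.Icc 1 I.stages) (hk : k ∈ Finset.Icc 1 I.iterations),
    ω (.inr (⟨i, hi⟩, ⟨k, hk⟩, S)) = true}

/-- The random family of sets returned by the algorithm. -/
noncomputable def solution (I : Input ι E) (ω : Coin I → Bool) : Finset ι :=
  algorithm I (choices I ω)

/-- The expected number of sets returned by the algorithm. -/
noncomputable def expectedSize (I : Input ι E) : ℝ :=
  ∫ ω, ((solution I ω).card : ℝ) ∂coinMeasure I

end

end RepeatedSparsification

/-!
The random process without sparsification, the *idealised process*, never lets an element pretend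
to be covered. It is easy to analyse: after stage `i` every set has, up to tiny tail probabilities,
at most `O(s / 2 ^ i)` free elements, so the expected number of elements that are still free is
`O(s / 2 ^ i)` times the value of any fractional cover. Within a stage, the sampling rate at most
doubles per iteration, so the expected number of sets added around a free element in one iteration
is at most twice the probability that the element stopped being free in the previous one; in total
this is `O(1)` for each element that is free at the beginning of the stage. As the large sets have
at least a constant times `s / 2 ^ i` free elements, each stage costs `O(1)` times the fractional
optimum, and there are `⌈log₂ s⌉` stages.

The actual algorithm is coupled to this process through the same random bits. The two differ at an
element only if a tail event occurred at one of the sets near it, and each step enlarges the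
relevant neighbourhood by a factor of at most `2 + t + s t`. The resulting error probability is
therefore independent of the number of elements, and `exp (-Λ ^ 5 / 2)` beats the accumulated
factor as soon as `Λ` exceeds an absolute constant. For smaller `Λ` the product `s t` is bounded,
and any cover by nonempty sets is good enough.
-/

namespace RepeatedSparsification

section Measure

variable {Ω : Type*} [MeasurableSpace Ω] {μ : Measure Ω}

theorem measureReal_le_add_of_imp_or [IsFiniteMeasure μ] {P Q R : Ω → Prop}
    (h : ∀ ω, P ω → Q ω ∨ R ω) :
    μ.real {ω | P ω} ≤ μ.real {ω | Q ω} + μ.real {ω | R ω} :=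
  (measureReal_mono h).trans (measureReal_union_le _ _)

theorem measureReal_exists_mem_le {β : Type*} [IsFiniteMeasure μ] {X : Finset β} {m : ℕ}
    (hX : X.card ≤ m) {P : β → Ω → Prop} {a : ℝ} (ha : 0 ≤ a)
    (h : ∀ x ∈ X, μ.real {ω | P x ω} ≤ a) : μ.real {ω | ∃ x ∈ X, P x ω} ≤ m * a := by
  calc μ.real {ω | ∃ x ∈ X, P x ω} = μ.real (⋃ x ∈ X, {ω | P x ω}) := by
        congr 1
        ext ω
        simp
    _ ≤ ∑ x ∈ X, μ.real {ω | P x ω} := measureReal_biUnion_finset_le X _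
    _ ≤ X.card • a := Finset.sum_le_card_nsmul X _ a h
    _ ≤ m * a := by
        rw [nsmul_eq_mul]
        gcongr

theorem integral_ite_one_zero [DiscreteMeasurableSpace Ω] (P : Ω → Prop) [DecidablePred P] :
    ∫ ω, (if P ω then (1 : ℝ) else 0) ∂μ = μ.real {ω | P ω} := by
  rw [← integral_indicator_one .of_discrete]
  simp only [Set.indicator_apply, Set.mem_ofPred_eq, Pi.one_apply]

end Measure

section RandomBits

variable {κ J : Type*} [Fintype κ]

/-- The joint law of independent random bits, where the bit `c` is `true` with probability `p c`. -/
noncomputable def bitMeasure (p : κ → unitInterval) : Measure (κ → Bool) :=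
  Measure.pi fun c => bernoulliMeasure true false (p c)

variable (p : κ → unitInterval)

instance : IsProbabilityMeasure (bitMeasure p) :=
  inferInstanceAs (IsProbabilityMeasure (Measure.pi _))

theorem iIndepFun_eval_bitMeasure : iIndepFun (fun c ω => ω c) (bitMeasure p) :=
  iIndepFun_pi (X := fun _ b => b) fun _ => aemeasurable_id

theorem map_eval_bitMeasure (c : κ) :
    (bitMeasure p).map (fun ω => ω c) = bernoulliMeasure true false (p c) :=
  (measurePreserving_eval _ c).map_eq

theorem integral_eval_bitMeasure (c : κ) (g : Bool → ℝ) :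
    ∫ ω, g (ω c) ∂bitMeasure p = p c * g true + (1 - p c) * g false := by
  rw [← integral_map (φ := fun ω : κ → Bool => ω c) (measurable_pi_apply c).aemeasurable
    (by fun_prop), map_eval_bitMeasure, integral_bernoulliMeasure, smul_eq_mul, smul_eq_mul]

theorem map_comp_bitMeasure [Fintype J] {y : J → κ} (hy : y.Injective) :
    (bitMeasure p).map (fun ω => ω ∘ y) = bitMeasure (p ∘ y) := by
  have h := (iIndepFun_iff_map_fun_eq_pi_map fun _ => .of_discrete).1
    ((iIndepFun_eval_bitMeasure p).precomp hy)
  simp only [map_eval_bitMeasure] at h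
  exact h

theorem indepFun_restrict_comp_bitMeasure (y : J → κ) :
    IndepFun (fun ω (c : ↥(Set.range y)ᶜ) => ω c) (fun ω => ω ∘ y) (bitMeasure p) := by
  classical
  have h := (iIndepFun_eval_bitMeasure p).indepFun_finset
    {c | c ∉ Set.range y} {c | c ∈ Set.range y}
    (by rw [Finset.disjoint_filter]; tauto) (fun c => measurable_pi_apply c)
  exact h.comp
    (φ := fun u (c : ↥(Set.range y)ᶜ) => u ⟨c, Finset.mem_filter.2 ⟨Finset.mem_univ _, c.2⟩⟩)
    (ψ := fun u j => u ⟨y j, by simp⟩) (measurable_pi_lambda _ fun _ => measurable_pi_apply _)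
    (measurable_pi_lambda _ fun _ => measurable_pi_apply _)

theorem integral_eq_integral_resample [Fintype J] {y : J → κ} (hy : y.Injective)
    {f : (κ → Bool) → (J → Bool) → ℝ} (hf : DependsOn f (Set.range y)ᶜ) :
    ∫ ω, f ω (ω ∘ y) ∂bitMeasure p = ∫ ω, ∫ η, f ω η ∂bitMeasure (p ∘ y) ∂bitMeasure p := by
  obtain ⟨g, rfl⟩ := dependsOn_iff_exists_comp.1 hf
  have hX : Measurable fun (ω : κ → Bool) (c : ↥(Set.range y)ᶜ) => ω c := .of_discrete
  have hY : Measurable fun ω : κ → Bool => ω ∘ y := .of_discrete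
  have hlaw := (indepFun_iff_map_prod_eq_prod_map_map hX.aemeasurable hY.aemeasurable).1
    (indepFun_restrict_comp_bitMeasure p y)
  rw [map_comp_bitMeasure p hy] at hlaw
  calc ∫ ω, g (fun c => ω c) (ω ∘ y) ∂bitMeasure p
      = ∫ z, g z.1 z.2 ∂(bitMeasure p).map fun ω => (fun c : ↥(Set.range y)ᶜ => ω c, ω ∘ y) :=
        (integral_map (hX.prodMk hY).aemeasurable .of_discrete (f := fun z => g z.1 z.2)).symm
    _ = ∫ u, ∫ η, g u η ∂bitMeasure (p ∘ y)
          ∂(bitMeasure p).map fun ω (c : ↥(Set.range y)ᶜ) => ω c := by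
        rw [hlaw, integral_prod _ .of_finite]
    _ = _ := integral_map hX.aemeasurable .of_discrete

theorem measureReal_resample_le [Fintype J] {y : J → κ} (hy : y.Injective)
    {P : (κ → Bool) → (J → Bool) → Prop} (hP : DependsOn P (Set.range y)ᶜ) {a : ℝ}
    (h : ∀ ω, (bitMeasure (p ∘ y)).real {η | P ω η} ≤ a) :
    (bitMeasure p).real {ω | P ω (ω ∘ y)} ≤ a := by
  classical
  have hresample := integral_eq_integral_resample p hy
    (f := fun ω η => {η | P ω η}.indicator 1 η) fun ω ω' hω => by
      have := hP hω
      simp only [this]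
  calc (bitMeasure p).real {ω | P ω (ω ∘ y)}
      = ∫ ω, {η | P ω η}.indicator 1 (ω ∘ y) ∂bitMeasure p :=
        (integral_indicator_one .of_discrete).symm
    _ = ∫ ω, (bitMeasure (p ∘ y)).real {η | P ω η} ∂bitMeasure p := by
        simp only [hresample, integral_indicator_one MeasurableSet.of_discrete]
    _ ≤ ∫ _, a ∂bitMeasure p := integral_mono .of_finite .of_finite h
    _ = a := by simp

theorem measureReal_eval_eq_false (c : κ) : (bitMeasure p).real {ω | ω c = false} = 1 - p c := by
  have h := integral_eval_bitMeasure p c fun b => if b = false then 1 else 0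
  rw [← integral_indicator_one .of_discrete]
  simpa [Set.indicator_apply] using h

theorem measureReal_forall_mem_eq_false (N : Finset κ) :
    (bitMeasure p).real {ω | ∀ c ∈ N, ω c = false} = ∏ c ∈ N, (1 - (p c : ℝ)) := by
  have h := (iIndepFun_eval_bitMeasure p).measure_inter_preimage_eq_mul N
    (sets := fun _ => {false}) fun _ _ => .of_discrete
  simp only [Set.preimage, Set.mem_singleton_iff] at h
  rw [measureReal_def, show {ω | ∀ c ∈ N, ω c = false} = ⋂ c ∈ N, {ω : κ → Bool | ω c = false} by
    ext; simp, h, ENNReal.toReal_prod]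
  exact Finset.prod_congr rfl fun c _ => measureReal_eval_eq_false p c

theorem integral_card_filter_eq_true (N : Finset κ) :
    ∫ ω, ({c ∈ N | ω c = true}.card : ℝ) ∂bitMeasure p = ∑ c ∈ N, (p c : ℝ) := by
  simp only [Finset.card_filter, Nat.cast_sum]
  rw [integral_finsetSum _ fun _ _ => .of_finite]
  refine Finset.sum_congr rfl fun c _ => ?_
  simpa using integral_eval_bitMeasure p c fun b => ((if b = true then 1 else 0 : ℕ) : ℝ)

theorem mgf_card_filter_eq_true (N : Finset κ) (x : ℝ) :
    mgf (fun ω => ({c ∈ N | ω c = true}.card : ℝ)) (bitMeasure p) x =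
      ∏ c ∈ N, (p c * Real.exp x + (1 - p c)) := by
  have hind := (iIndepFun_eval_bitMeasure p).comp (fun _ b => if b = true then (1 : ℝ) else 0)
    fun _ => .of_discrete
  rw [show (fun ω : κ → Bool => ({c ∈ N | ω c = true}.card : ℝ)) =
      ∑ c ∈ N, (fun b => if b = true then (1 : ℝ) else 0) ∘ fun ω => ω c by
    ext ω; simp [Finset.sum_apply], hind.mgf_sum fun _ => .of_discrete]
  refine Finset.prod_congr rfl fun c _ => ?_
  simpa [mgf] using
    integral_eval_bitMeasure p c fun b => Real.exp (x * if b = true then 1 else 0)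

theorem measureReal_le_card_filter_eq_true_le (N : Finset κ) (a : ℝ) :
    (bitMeasure p).real {ω | a ≤ ({c ∈ N | ω c = true}.card : ℝ)} ≤
      Real.exp (2 * ∑ c ∈ N, (p c : ℝ) - a) := by
  refine (measure_ge_le_exp_mul_mgf a zero_le_one .of_finite).trans ?_
  rw [mgf_card_filter_eq_true, sub_eq_neg_add, Real.exp_add, Finset.mul_sum,
    Real.exp_sum, neg_one_mul]
  gcongr with c
  · exact fun c _ => by have := (p c).2.2; have := (p c).2.1; positivity
  · nlinarith [Real.add_one_le_exp (2 * (p c : ℝ)), Real.exp_one_lt_d9, (p c).2.1]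

theorem measureReal_card_filter_eq_true_le_le (N : Finset κ) (a : ℝ) :
    (bitMeasure p).real {ω | ({c ∈ N | ω c = true}.card : ℝ) ≤ a} ≤
      Real.exp (a - (∑ c ∈ N, (p c : ℝ)) / 2) := by
  refine (measure_le_le_exp_mul_mgf a (neg_one_lt_zero).le .of_finite).trans ?_
  rw [mgf_card_filter_eq_true, sub_eq_add_neg, Real.exp_add, Finset.sum_div,
    ← Finset.sum_neg_distrib, Real.exp_sum, neg_neg, one_mul]
  have hexp : Real.exp (-1) ≤ 1 / 2 := by
    linarith [Real.exp_neg_one_lt_d9]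
  gcongr with c
  · exact fun c _ => by have := (p c).2.2; have := (p c).2.1; positivity
  · nlinarith [Real.add_one_le_exp (-((p c : ℝ) / 2)), (p c).2.1]

section Block

variable {p} {y : J → κ} (hy : y.Injective) {N : (κ → Bool) → Finset J}

include hy

theorem measureReal_and_le_card_filter_le {φ : (κ → Bool) → Prop}
    (hφ : DependsOn φ (Set.range y)ᶜ) (hN : DependsOn N (Set.range y)ᶜ) {a b : ℝ}
    (hb : ∀ ω, φ ω → 2 * ∑ j ∈ N ω, (p (y j) : ℝ) ≤ b) :
    (bitMeasure p).real {ω | φ ω ∧ a ≤ ({j ∈ N ω | ω (y j) = true}.card : ℝ)} ≤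
      Real.exp (b - a) := by
  have := Fintype.ofInjective y hy
  refine measureReal_resample_le p hy
    (P := fun ω η => φ ω ∧ a ≤ ({j ∈ N ω | η j = true}.card : ℝ))
    (fun ω ω' h => by simp only [hφ h, hN h]) fun ω => ?_
  by_cases hω : φ ω
  · simp only [hω, true_and]
    exact (measureReal_le_card_filter_eq_true_le _ _ _).trans
      (Real.exp_le_exp.2 (sub_le_sub_right (hb ω hω) a))
  · simp [hω, Real.exp_nonneg]

theorem measureReal_and_card_filter_le_le {φ : (κ → Bool) → Prop}
    (hφ : DependsOn φ (Set.range y)ᶜ) (hN : DependsOn N (Set.range y)ᶜ) {a b : ℝ}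
    (hb : ∀ ω, φ ω → b ≤ (∑ j ∈ N ω, (p (y j) : ℝ)) / 2) :
    (bitMeasure p).real {ω | φ ω ∧ ({j ∈ N ω | ω (y j) = true}.card : ℝ) ≤ a} ≤
      Real.exp (a - b) := by
  have := Fintype.ofInjective y hy
  refine measureReal_resample_le p hy
    (P := fun ω η => φ ω ∧ ({j ∈ N ω | η j = true}.card : ℝ) ≤ a)
    (fun ω ω' h => by simp only [hφ h, hN h]) fun ω => ?_
  by_cases hω : φ ω
  · simp only [hω, true_and]
    exact (measureReal_card_filter_eq_true_le_le _ _ _).trans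
      (Real.exp_le_exp.2 (sub_le_sub_left (hb ω hω) a))
  · simp [hω, Real.exp_nonneg]

theorem measureReal_and_forall_eq_false_le {φ : (κ → Bool) → Prop}
    (hφ : DependsOn φ (Set.range y)ᶜ) (hN : DependsOn N (Set.range y)ᶜ) {a : ℝ} (ha : 0 ≤ a)
    (hb : ∀ ω, φ ω → ∏ j ∈ N ω, (1 - (p (y j) : ℝ)) ≤ a) :
    (bitMeasure p).real {ω | φ ω ∧ ∀ j ∈ N ω, ω (y j) = false} ≤ a := by
  have := Fintype.ofInjective y hy
  refine measureReal_resample_le p hy (P := fun ω η => φ ω ∧ ∀ j ∈ N ω, η j = false)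
    (fun ω ω' h => by simp only [hφ h, hN h]) fun ω => ?_
  by_cases hω : φ ω
  · simp only [hω, true_and]
    exact (measureReal_forall_mem_eq_false _ _).trans_le (hb ω hω)
  · simp [hω, ha]

theorem integral_mul_forall_eq_false {φ : (κ → Bool) → ℝ}
    (hφ : DependsOn φ (Set.range y)ᶜ) (hN : DependsOn N (Set.range y)ᶜ) :
    ∫ ω, φ ω * (if ∀ j ∈ N ω, ω (y j) = false then 1 else 0) ∂bitMeasure p =
      ∫ ω, φ ω * ∏ j ∈ N ω, (1 - (p (y j) : ℝ)) ∂bitMeasure p := by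
  have := Fintype.ofInjective y hy
  refine (integral_eq_integral_resample p hy
    (f := fun ω η => φ ω * if ∀ j ∈ N ω, η j = false then 1 else 0)
    fun ω ω' h => by simp only [hφ h, hN h]).trans ?_
  refine integral_congr_ae (.of_forall fun ω => ?_)
  have h := measureReal_forall_mem_eq_false (p ∘ y) (N ω)
  rw [← integral_indicator_one .of_discrete] at h
  simp only [Set.indicator_apply, Set.mem_ofPred_eq, Pi.one_apply] at h
  exact (integral_const_mul _ _).trans (congrArg _ h)

theorem integral_mul_card_filter_eq_true {φ : (κ → Bool) → ℝ}
    (hφ : DependsOn φ (Set.range y)ᶜ) (hN : DependsOn N (Set.range y)ᶜ) :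
    ∫ ω, φ ω * ({j ∈ N ω | ω (y j) = true}.card : ℝ) ∂bitMeasure p =
      ∫ ω, φ ω * ∑ j ∈ N ω, (p (y j) : ℝ) ∂bitMeasure p := by
  have := Fintype.ofInjective y hy
  refine (integral_eq_integral_resample p hy
    (f := fun ω η => φ ω * ({j ∈ N ω | η j = true}.card : ℝ))
    fun ω ω' h => by simp only [hφ h, hN h]).trans ?_
  refine integral_congr_ae (.of_forall fun ω => ?_)
  exact (integral_const_mul _ _).trans (congrArg _ (integral_card_filter_eq_true _ _))

end Block

end RandomBits

section Regular

variable {ι E : Type*} [Fintype ι] [DecidableEq E]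

/-- The standing assumptions on the input: `s` and `t` bound the sizes of the sets and the degrees
of the elements, and `Λ` is at least one. -/
structure Regular (I : Input ι E) : Prop where
  two_le_s : 2 ≤ I.s
  two_le_t : 2 ≤ I.t
  card_le : ∀ S, (I.A S).card ≤ I.s
  degree_le : ∀ e, elemDegree I.A Finset.univ e ≤ I.t
  one_le_Λ : 1 ≤ I.Λ

namespace Regular

variable {I : Input ι E} (hI : Regular I)
include hI

theorem s_pos : (0 : ℝ) < I.s := Nat.cast_pos.2 (zero_lt_two.trans_le hI.two_le_s)

theorem t_pos : (0 : ℝ) < I.t := Nat.cast_pos.2 (zero_lt_two.trans_le hI.two_le_t)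

theorem Λ_pos : 0 < I.Λ := one_pos.trans_le hI.one_le_Λ

theorem sampleProb_pos (i : ℕ) : 0 < I.sampleProb i := by
  have := hI.s_pos
  have := hI.Λ_pos
  exact lt_min one_pos (by positivity)

theorem familyProb_pos (k : ℕ) : 0 < I.familyProb k := by
  have := hI.t_pos
  exact lt_min one_pos (by positivity)

theorem coinProb_mem (x : Coin I) : coinProb I x ∈ Set.Icc (0 : ℝ) 1 := by
  rcases x with x | x
  · exact ⟨(hI.sampleProb_pos _).le, min_le_left _ _⟩
  · exact ⟨(hI.familyProb_pos _).le, min_le_left _ _⟩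

end Regular

end Regular

section Coins

variable {ι E : Type*} {I : Input ι E}

/-- The probabilities of the random bits, as numbers of the unit interval. -/
noncomputable def coinBias (I : Input ι E) (x : Coin I) : unitInterval :=
  Set.projIcc (0 : ℝ) 1 zero_le_one (coinProb I x)

theorem coinMeasure_eq [Fintype ι] [Fintype E] (I : Input ι E) :
    coinMeasure I = bitMeasure (coinBias I) := rfl

instance [Fintype ι] [Fintype E] (I : Input ι E) : IsProbabilityMeasure (coinMeasure I) :=
  inferInstanceAs (IsProbabilityMeasure (bitMeasure (coinBias I)))

theorem Regular.coe_coinBias [Fintype ι] [DecidableEq E] (hI : Regular I) (x : Coin I) :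
    (coinBias I x : ℝ) = coinProb I x :=
  congrArg Subtype.val (Set.projIcc_of_mem zero_le_one (hI.coinProb_mem x))

/-- The bits determining the family `S_{i,k}`. -/
def familyCoin {i k : ℕ} (hi : i ∈ Finset.Icc 1 I.stages) (hk : k ∈ Finset.Icc 1 I.iterations) :
    ι → Coin I :=
  fun S => .inr (⟨i, hi⟩, ⟨k, hk⟩, S)

/-- The bits determining the subset `B_i(S)`. -/
def sampleCoin {i : ℕ} (hi : i ∈ Finset.Icc 1 I.stages) (S : ι) : E → Coin I :=
  fun e => .inl (⟨i, hi⟩, S, e)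

theorem familyCoin_injective {i k : ℕ} (hi : i ∈ Finset.Icc 1 I.stages)
    (hk : k ∈ Finset.Icc 1 I.iterations) : Function.Injective (familyCoin (I := I) hi hk) :=
  fun S T h => by simpa [familyCoin] using h

theorem sampleCoin_injective {i : ℕ} (hi : i ∈ Finset.Icc 1 I.stages) (S : ι) :
    Function.Injective (sampleCoin (I := I) hi S) :=
  fun e e' h => by simpa [sampleCoin] using h

variable [Fintype ι]

theorem mem_choices_F {i k : ℕ} (hi : i ∈ Finset.Icc 1 I.stages)
    (hk : k ∈ Finset.Icc 1 I.iterations) {ω : Coin I → Bool} {S : ι} :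
    S ∈ (choices I ω).F i k ↔ ω (familyCoin hi hk S) = true := by
  simp only [choices, Finset.mem_filter, Finset.mem_univ, true_and, familyCoin]
  exact ⟨fun ⟨_, _, h⟩ => h, fun h => ⟨hi, hk, h⟩⟩

theorem mem_choices_B {i : ℕ} (hi : i ∈ Finset.Icc 1 I.stages) {ω : Coin I → Bool} {S : ι}
    {e : E} : e ∈ (choices I ω).B i S ↔ e ∈ I.A S ∧ ω (sampleCoin hi S e) = true := by
  simp only [choices, Finset.mem_filter, sampleCoin]
  exact and_congr_right fun _ => ⟨fun ⟨_, h⟩ => h, fun h => ⟨hi, h⟩⟩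

theorem dependsOn_B_compl_familyCoin {i k : ℕ} (hi : i ∈ Finset.Icc 1 I.stages)
    (hk : k ∈ Finset.Icc 1 I.iterations) :
    DependsOn (fun ω => (choices I ω).B) (Set.range (familyCoin (I := I) hi hk))ᶜ := by
  intro ω ω' h
  funext j S
  ext e
  simp only [choices, Finset.mem_filter]
  refine and_congr_right fun _ => exists_congr fun hj => ?_
  rw [h _ (by simp [familyCoin])]

theorem dependsOn_F_compl_familyCoin {i k : ℕ} (hi : i ∈ Finset.Icc 1 I.stages)
    (hk : k ∈ Finset.Icc 1 I.iterations) {i' k' : ℕ} (hne : i' ≠ i ∨ k' ≠ k) :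
    DependsOn (fun ω => (choices I ω).F i' k') (Set.range (familyCoin (I := I) hi hk))ᶜ := by
  intro ω ω' h
  ext S
  simp only [choices, Finset.mem_filter, Finset.mem_univ, true_and]
  refine exists_congr fun hj => exists_congr fun hj' => ?_
  rw [h]
  simp only [familyCoin, Set.mem_compl_iff, Set.mem_range, Sum.inr.injEq, Prod.mk.injEq,
    Subtype.mk.injEq, exists_eq_right_right]
  rintro ⟨rfl, rfl⟩
  simp at hne

theorem dependsOn_F_compl_sampleCoin {i : ℕ} (hi : i ∈ Finset.Icc 1 I.stages) (S : ι) :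
    DependsOn (fun ω => (choices I ω).F) (Set.range (sampleCoin (I := I) hi S))ᶜ := by
  intro ω ω' h
  funext j k
  ext T
  simp only [choices, Finset.mem_filter, Finset.mem_univ, true_and]
  refine exists_congr fun hj => exists_congr fun hj' => ?_
  rw [h _ (by simp [sampleCoin])]

theorem dependsOn_B_compl_sampleCoin {i : ℕ} (hi : i ∈ Finset.Icc 1 I.stages) (S : ι) {i' : ℕ}
    {S' : ι} (hne : i' ≠ i ∨ S' ≠ S) :
    DependsOn (fun ω => (choices I ω).B i' S') (Set.range (sampleCoin (I := I) hi S))ᶜ := by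
  intro ω ω' h
  ext e
  simp only [choices, Finset.mem_filter]
  refine and_congr_right fun _ => exists_congr fun hj => ?_
  rw [h]
  simp only [sampleCoin, Set.mem_compl_iff, Set.mem_range, Sum.inl.injEq, Prod.mk.injEq,
    Subtype.mk.injEq, not_exists]
  rintro _ ⟨rfl, rfl, _⟩
  simp at hne

end Coins

section Choices

variable {ι E : Type*}

/-- The sampled subsets are indeed subsets of the sets of the input. -/
def Choices.Proper (I : Input ι E) (c : Choices ι E) : Prop := ∀ i S, c.B i S ⊆ I.A S

theorem choices_proper [Fintype ι] {I : Input ι E} (ω : Coin I → Bool) :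
    (choices I ω).Proper I :=
  fun _ _ => Finset.filter_subset _ _

/-- The choices with the set `S` removed from all sampled families of stage `i`. -/
def Choices.drop [DecidableEq ι] (c : Choices ι E) (i : ℕ) (S : ι) : Choices ι E :=
  ⟨c.B, fun i' k => if i' = i then (c.F i' k).erase S else c.F i' k⟩

theorem Choices.drop_F_self [DecidableEq ι] (c : Choices ι E) (i k : ℕ) (S : ι) :
    (c.drop i S).F i k = (c.F i k).erase S := if_pos rfl

end Choices

section Large

variable {ι E : Type*} [DecidableEq E] {I : Input ι E} {c c' : Choices ι E} {i : ℕ}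
  {st st' : State ι E} {S : ι}

theorem isLarge_congr (h : c.B i S ∩ st.free = c'.B i S ∩ st'.free) :
    IsLarge I c i st S ↔ IsLarge I c' i st' S := by
  rw [IsLarge, IsLarge, estDegree, estDegree, h]

theorem isLarge_iff [Fintype ι] (hI : Regular I) :
    IsLarge I c i st S ↔ (I.s : ℝ) / 2 ^ i * I.sampleProb i ≤ ((c.B i S ∩ st.free).card : ℝ) := by
  rw [IsLarge, estDegree, le_div_iff₀ (hI.sampleProb_pos i)]

namespace IsLarge

variable [Fintype ι]

theorem mono (hI : Regular I) (hst : st'.free ⊆ st.free) (h : IsLarge I c i st' S) :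
    IsLarge I c i st S := by
  rw [isLarge_iff hI] at h ⊢
  exact h.trans (by gcongr)

theorem nonempty (hI : Regular I) (h : IsLarge I c i st S) : (c.B i S ∩ st.free).Nonempty := by
  rw [isLarge_iff hI] at h
  rw [← Finset.card_pos]
  have hs := hI.s_pos
  have hp := hI.sampleProb_pos i
  have hpos : (0 : ℝ) < (I.s : ℝ) / 2 ^ i * I.sampleProb i := by positivity
  exact_mod_cast hpos.trans_le h

theorem not_disjoint (hI : Regular I) (hc : c.Proper I) (h : IsLarge I c i st S) :
    ¬ Disjoint (I.A S) st.free := by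
  rw [Finset.not_disjoint_iff_nonempty_inter]
  exact (h.nonempty hI).mono (Finset.inter_subset_inter_right (hc i S))

end IsLarge

end Large

section Ideal

variable {ι E : Type*} [LinearOrder ι] [DecidableEq E]

theorem mem_addSets_free {A : ι → Finset E} {st : State ι E} {X : Finset ι} {e : E} :
    e ∈ (st.addSets A X).free ↔ e ∈ st.free ∧ ∀ S ∈ X, e ∉ A S := by
  simp [State.addSets]

open scoped Classical in
/-- Iteration `k` of stage `i` of the idealised process: all sets of `S_{i,k}` that are large are
added, and no element ever pretends to be covered. -/
noncomputable def idealStep (I : Input ι E) (c : Choices ι E) (i k : ℕ) (st : State ι E) :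
    State ι E :=
  st.addSets I.A {S ∈ c.F i k | IsLarge I c i st S}

/-- The first iterations, as many as the last argument says, of stage `i` of the idealised
process. -/
noncomputable def idealStage (I : Input ι E) (c : Choices ι E) (i : ℕ) (st : State ι E) :
    ℕ → State ι E
  | 0 => st
  | n + 1 => idealStep I c i (n + 1) (idealStage I c i st n)

/-- The state of the idealised process after the given number of stages. -/
noncomputable def idealStart [Fintype E] (I : Input ι E) (c : Choices ι E) : ℕ → State ι E
  | 0 => ⟨∅, Finset.univ⟩
  | i + 1 => idealStage I c (i + 1) (idealStart I c i) I.iterations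

/-- The state of the idealised process after `n` iterations of stage `i + 1`; stages and iterations
are numbered from one. -/
noncomputable def ideal [Fintype E] (I : Input ι E) (c : Choices ι E) (i n : ℕ) : State ι E :=
  idealStage I c (i + 1) (idealStart I c i) n

variable {I : Input ι E} {c c' : Choices ι E}

theorem idealStage_congr {i : ℕ} {st : State ι E} {n : ℕ}
    (hF : ∀ k, k < n → c.F i (k + 1) = c'.F i (k + 1))
    (hB : ∀ k, k < n → ∀ S ∈ c.F i (k + 1), c.B i S = c'.B i S) :
    idealStage I c i st n = idealStage I c' i st n := by
  induction n with
  | zero => rfl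
  | succ n ih =>
    have ih := ih (fun k _ => hF k (by omega)) fun k _ => hB k (by omega)
    simp only [idealStage, idealStep]
    rw [ih]
    congr 1
    ext S
    simp only [Finset.mem_filter, ← hF n (Nat.lt_succ_self n)]
    refine and_congr_right fun hS => isLarge_congr ?_
    rw [hB n (Nat.lt_succ_self n) S hS]

theorem mem_idealStage_free_iff {i : ℕ} {st : State ι E} {e : E}
    (h : e ∈ st.free ↔ ∀ S ∈ st.cover, e ∉ I.A S) (n : ℕ) :
    e ∈ (idealStage I c i st n).free ↔ ∀ S ∈ (idealStage I c i st n).cover, e ∉ I.A S := by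
  induction n with
  | zero => exact h
  | succ n ih =>
    rw [idealStage, idealStep, mem_addSets_free, ih]
    simp only [State.addSets, Finset.mem_union, or_imp, forall_and]

variable [Fintype E]

theorem idealStart_congr {i : ℕ}
    (hF : ∀ j, j < i → ∀ k, c.F (j + 1) (k + 1) = c'.F (j + 1) (k + 1))
    (hB : ∀ j, j < i → ∀ S, c.B (j + 1) S = c'.B (j + 1) S) :
    idealStart I c i = idealStart I c' i := by
  induction i with
  | zero => rfl
  | succ i ih =>
    simp only [idealStart]
    rw [ih (fun j hj => hF j (by omega)) fun j hj => hB j (by omega)]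
    exact idealStage_congr (fun k _ => hF i (by omega) k) fun k _ S _ => hB i (by omega) S

theorem mem_ideal_free_iff {i n : ℕ} {e : E} :
    e ∈ (ideal I c i n).free ↔ ∀ S ∈ (ideal I c i n).cover, e ∉ I.A S := by
  refine mem_idealStage_free_iff ?_ n
  induction i with
  | zero => simp [idealStart]
  | succ i ih => exact mem_idealStage_free_iff ih _

theorem ideal_succ (i n : ℕ) :
    ideal I c i (n + 1) = idealStep I c (i + 1) (n + 1) (ideal I c i n) := rfl

theorem ideal_iterations (i : ℕ) : ideal I c i I.iterations = ideal I c (i + 1) 0 := rfl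

theorem ideal_free_antitone (i : ℕ) : Antitone fun n => (ideal I c i n).free :=
  antitone_nat_of_succ_le fun _ => Finset.sdiff_subset

theorem mem_ideal_free_succ {i n : ℕ} {e : E} :
    e ∈ (ideal I c i (n + 1)).free ↔ e ∈ (ideal I c i n).free ∧
      ∀ S ∈ c.F (i + 1) (n + 1), IsLarge I c (i + 1) (ideal I c i n) S → e ∉ I.A S := by
  rw [ideal_succ, idealStep, mem_addSets_free]
  simp only [Finset.mem_filter, and_imp]

theorem disjoint_ideal_free_of_isLarge {i n m : ℕ} {S : ι} (hS : S ∈ c.F (i + 1) (n + 1))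
    (hl : IsLarge I c (i + 1) (ideal I c i n) S) (hm : n < m) :
    Disjoint (I.A S) (ideal I c i m).free := by
  refine Disjoint.mono_right (ideal_free_antitone i (Nat.succ_le_of_lt hm)) ?_
  rw [Finset.disjoint_left]
  exact fun e he h => (mem_ideal_free_succ.1 h).2 S hS hl he

theorem ideal_drop {i n : ℕ} {S : ι}
    (h : ∀ m < n, S ∈ c.F (i + 1) (m + 1) → ¬ IsLarge I c (i + 1) (ideal I c i m) S) :
    ideal I (c.drop (i + 1) S) i n = ideal I c i n := by
  induction n with
  | zero =>
    refine idealStart_congr (fun j _ k => ?_) fun j _ S => rfl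
    simp only [Choices.drop]
    rw [if_neg (by omega)]
  | succ n ih =>
    rw [ideal_succ, ideal_succ, ih fun m hm => h m (by omega), idealStep, idealStep]
    congr 1
    ext T
    have hlarge : IsLarge I (c.drop (i + 1) S) (i + 1) (ideal I c i n) T ↔
        IsLarge I c (i + 1) (ideal I c i n) T := Iff.rfl
    simp only [Finset.mem_filter, Choices.drop_F_self, Finset.mem_erase, and_assoc, hlarge]
    exact and_iff_right_of_imp fun hT hTS => h n (Nat.lt_succ_self n) (hTS ▸ hT.1) (hTS ▸ hT.2)

theorem ideal_drop_of_not_disjoint {i n : ℕ} {S : ι}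
    (h : ¬ Disjoint (I.A S) (ideal I c i n).free) :
    ideal I (c.drop (i + 1) S) i n = ideal I c i n :=
  ideal_drop fun _ hm hS hl => h (disjoint_ideal_free_of_isLarge hS hl hm)

variable [Fintype ι]

theorem dependsOn_ideal_compl_familyCoin {i k n : ℕ} (hi : i + 1 ∈ Finset.Icc 1 I.stages)
    (hk : k ∈ Finset.Icc 1 I.iterations) (hn : n < k) :
    DependsOn (fun ω => ideal I (choices I ω) i n) (Set.range (familyCoin (I := I) hi hk))ᶜ := by
  intro ω ω' h
  have hB : (choices I ω).B = (choices I ω').B := dependsOn_B_compl_familyCoin hi hk h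
  have hF {i' k'} (hne : i' ≠ i + 1 ∨ k' ≠ k) :
      (choices I ω).F i' k' = (choices I ω').F i' k' := dependsOn_F_compl_familyCoin hi hk hne h
  simp only [ideal]
  rw [idealStart_congr (c' := choices I ω') (fun j _ k => hF (by omega)) fun j _ S => by rw [hB]]
  exact idealStage_congr (fun k _ => hF (by omega)) fun k _ S _ => by rw [hB]

theorem dependsOn_ideal_zero_compl_sampleCoin {i : ℕ} (hi : i + 1 ∈ Finset.Icc 1 I.stages)
    (S : ι) :
    DependsOn (fun ω => ideal I (choices I ω) i 0) (Set.range (sampleCoin (I := I) hi S))ᶜ := by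
  intro ω ω' h
  have hF : (choices I ω).F = (choices I ω').F := dependsOn_F_compl_sampleCoin hi S h
  exact idealStart_congr (fun j _ k => by rw [hF])
    fun j _ S' => dependsOn_B_compl_sampleCoin hi S (by omega) h

theorem dependsOn_ideal_drop_compl_sampleCoin {i n : ℕ} (hi : i + 1 ∈ Finset.Icc 1 I.stages)
    (S : ι) : DependsOn (fun ω => ideal I ((choices I ω).drop (i + 1) S) i n)
      (Set.range (sampleCoin (I := I) hi S))ᶜ := by
  intro ω ω' h
  have hF : (choices I ω).F = (choices I ω').F := dependsOn_F_compl_sampleCoin hi S h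
  have hB {i' S'} (hne : i' ≠ i + 1 ∨ S' ≠ S) :
      (choices I ω).B i' S' = (choices I ω').B i' S' := dependsOn_B_compl_sampleCoin hi S hne h
  simp only [ideal]
  rw [idealStart_congr (c := (choices I ω).drop (i + 1) S) (c' := (choices I ω').drop (i + 1) S)
    (fun j _ k => by simp only [Choices.drop, hF]) fun j _ S => hB (by omega)]
  refine idealStage_congr (fun k _ => by simp only [Choices.drop, hF]) fun k _ T hT => ?_
  rw [Choices.drop_F_self, Finset.mem_erase] at hT
  exact hB (Or.inr hT.1)

end Ideal

section Parameters

variable {ι E : Type*} {I : Input ι E}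

/-- A common bound for the failure probabilities of the individual estimates. -/
noncomputable def failProb (I : Input ι E) : ℝ := Real.exp (-(I.Λ ^ 5 / 2))

theorem failProb_nonneg : 0 ≤ failProb I := (Real.exp_pos _).le

theorem exp_sub_le_failProb {a b : ℝ} (h : I.Λ ^ 5 / 2 ≤ a - b) : Real.exp (b - a) ≤ failProb I :=
  Real.exp_le_exp.2 (by linarith)

theorem thirtyTwo_le_Λ_pow (hΛ : 2 ≤ I.Λ) : 32 ≤ I.Λ ^ 5 := by
  calc (32 : ℝ) = 2 ^ 5 := by norm_num
    _ ≤ I.Λ ^ 5 := by gcongr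

theorem familyProb_le (k : ℕ) : I.familyProb k ≤ 2 ^ k / I.t := min_le_right _ _

theorem familyProb_succ_le (k : ℕ) : I.familyProb (k + 1) ≤ 2 * I.familyProb k := by
  rw [Input.familyProb, Input.familyProb, mul_min_of_nonneg _ _ zero_le_two, pow_succ, mul_one,
    ← mul_div_assoc, mul_comm 2]
  exact min_le_min_right _ one_le_two

theorem not_disjoint_of_lt_card_inter [DecidableEq E] {U V : Finset E} {a : ℝ} (ha : 0 ≤ a)
    (h : a < ((U ∩ V).card : ℝ)) : ¬ Disjoint U V := by
  rw [Finset.not_disjoint_iff_nonempty_inter, ← Finset.card_pos]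
  exact_mod_cast ha.trans_lt h

theorem mul_one_sub_pow_le {q : ℝ} (h0 : 0 ≤ q) (h1 : q ≤ 1) (d : ℕ) :
    d * q * (1 - q) ^ d ≤ 1 - (1 - q) ^ d := by
  have hpow : (0 : ℝ) ≤ (1 - q) ^ d := pow_nonneg (by linarith) d
  have hprod : (1 + q) ^ d * (1 - q) ^ d ≤ 1 := by
    rw [← mul_pow]
    exact pow_le_one₀ (by nlinarith) (by nlinarith)
  nlinarith [one_add_mul_le_pow (show -2 ≤ q by linarith) d]

end Parameters

section TailBounds

variable {ι E : Type*} [Fintype ι] [DecidableEq E] {I : Input ι E}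

theorem sampleProb_eq_one_or (hI : Regular I) (i : ℕ) :
    I.sampleProb i = 1 ∨ (I.s : ℝ) / 2 ^ i * I.sampleProb i = I.Λ ^ 5 := by
  have := hI.s_pos
  refine (min_choice (1 : ℝ) (I.Λ ^ 5 * (2 ^ i / I.s))).imp id fun h => ?_
  rw [Input.sampleProb, h]
  field_simp

theorem scale_mul_sampleProb_le (hI : Regular I) (i : ℕ) :
    (I.s : ℝ) / 2 ^ i * I.sampleProb i ≤ I.Λ ^ 5 := by
  have := hI.s_pos
  calc (I.s : ℝ) / 2 ^ i * I.sampleProb i ≤ I.s / 2 ^ i * (I.Λ ^ 5 * (2 ^ i / I.s)) := by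
        gcongr
        exact min_le_right _ _
    _ = I.Λ ^ 5 := by field_simp

theorem sum_coinBias_sampleCoin (hI : Regular I) {i : ℕ} (hi : i ∈ Finset.Icc 1 I.stages) (S : ι)
    (U : Finset E) : ∑ e ∈ U, (coinBias I (sampleCoin hi S e) : ℝ) = U.card * I.sampleProb i := by
  simp only [hI.coe_coinBias, coinProb, sampleCoin, Finset.sum_const, nsmul_eq_mul]

theorem sum_coinBias_familyCoin (hI : Regular I) {i k : ℕ} (hi : i ∈ Finset.Icc 1 I.stages)
    (hk : k ∈ Finset.Icc 1 I.iterations) (X : Finset ι) :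
    ∑ S ∈ X, (coinBias I (familyCoin hi hk S) : ℝ) = X.card * I.familyProb k := by
  simp only [hI.coe_coinBias, coinProb, familyCoin, Finset.sum_const, nsmul_eq_mul]

theorem prod_one_sub_coinBias_familyCoin (hI : Regular I) {i k : ℕ}
    (hi : i ∈ Finset.Icc 1 I.stages) (hk : k ∈ Finset.Icc 1 I.iterations) (X : Finset ι) :
    ∏ S ∈ X, (1 - (coinBias I (familyCoin hi hk S) : ℝ)) = (1 - I.familyProb k) ^ X.card := by
  simp only [hI.coe_coinBias, coinProb, familyCoin, Finset.prod_const]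

theorem B_inter_eq {i : ℕ} (hi : i ∈ Finset.Icc 1 I.stages) (S : ι) (U : Finset E)
    (ω : Coin I → Bool) :
    (choices I ω).B i S ∩ U = {e ∈ I.A S ∩ U | ω (sampleCoin hi S e) = true} := by
  ext e
  simp only [Finset.mem_inter, mem_choices_B hi, Finset.mem_filter]
  tauto

theorem iterations_pos (hI : Regular I) : 0 < I.iterations :=
  Nat.clog_pos (by norm_num) hI.two_le_t

theorem familyProb_iterations (hI : Regular I) : I.familyProb I.iterations = 1 := by
  refine min_eq_left ?_
  rw [one_le_div hI.t_pos]
  exact_mod_cast Nat.le_pow_clog (by norm_num) I.t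

theorem one_sub_familyProb_pow_le (hI : Regular I) {n d : ℕ}
    (hd : I.Λ ^ 5 * I.t / 2 ^ n < d) : (1 - I.familyProb n) ^ d ≤ failProb I := by
  have ht := hI.t_pos
  have hΛ := pow_pos hI.Λ_pos 5
  have hd_pos : (0 : ℝ) < d := lt_of_le_of_lt (by positivity) hd
  have hle : I.familyProb n ≤ 1 := min_le_left _ _
  rcases min_choice (1 : ℝ) (2 ^ n / I.t) with hq | hq
  · rw [Input.familyProb, hq, sub_self, zero_pow (by exact_mod_cast hd_pos.ne')]
    exact failProb_nonneg
  · have hmean : I.Λ ^ 5 ≤ (d : ℝ) * I.familyProb n := by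
      rw [Input.familyProb, hq]
      calc I.Λ ^ 5 = I.Λ ^ 5 * I.t / 2 ^ n * (2 ^ n / I.t) := by field_simp
        _ ≤ (d : ℝ) * (2 ^ n / I.t) := by gcongr
    calc (1 - I.familyProb n) ^ d ≤ Real.exp (-I.familyProb n) ^ d :=
          pow_le_pow_left₀ (by linarith) (Real.one_sub_le_exp_neg _) d
      _ = Real.exp (-(d * I.familyProb n)) := by rw [← Real.exp_nat_mul, mul_neg]
      _ ≤ failProb I := Real.exp_le_exp.2 (by linarith)

variable [Fintype E]

theorem measureReal_eq_false_eq_zero (hI : Regular I) {x : Coin I} (hx : coinProb I x = 1) :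
    (coinMeasure I).real {ω | ω x = false} = 0 := by
  rw [coinMeasure_eq, measureReal_eval_eq_false, hI.coe_coinBias, hx, sub_self]

theorem measureReal_B_ne_eq_zero (hI : Regular I) {i : ℕ} (hi : i ∈ Finset.Icc 1 I.stages)
    (hp : I.sampleProb i = 1) (S : ι) :
    (coinMeasure I).real {ω | (choices I ω).B i S ≠ I.A S} = 0 := by
  refine le_antisymm ?_ measureReal_nonneg
  calc (coinMeasure I).real {ω | (choices I ω).B i S ≠ I.A S}
      ≤ (coinMeasure I).real (⋃ e ∈ I.A S, {ω | ω (sampleCoin hi S e) = false}) := by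
        refine measureReal_mono (fun ω hω => ?_) (measure_ne_top _ _)
        obtain ⟨e, heS, he⟩ := Finset.exists_of_ssubset
          ((choices_proper ω i S).ssubset_of_ne hω)
        simp only [mem_choices_B hi, heS, true_and, Bool.not_eq_true] at he
        exact Set.mem_biUnion heS he
    _ ≤ ∑ e ∈ I.A S, (coinMeasure I).real {ω | ω (sampleCoin hi S e) = false} :=
        measureReal_biUnion_finset_le _ _
    _ = 0 := Finset.sum_eq_zero fun e _ => measureReal_eq_false_eq_zero hI hp

end TailBounds

section FreeElements

variable {ι E : Type*} [Fintype ι] [LinearOrder ι] [Fintype E] [DecidableEq E] {I : Input ι E}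

theorem dependsOn_inter_ideal_drop_compl_sampleCoin {i : ℕ}
    (hi : i + 1 ∈ Finset.Icc 1 I.stages) (n : ℕ) (S : ι) :
    DependsOn (fun ω => I.A S ∩ (ideal I ((choices I ω).drop (i + 1) S) i n).free)
      (Set.range (sampleCoin (I := I) hi S))ᶜ :=
  fun _ _ h => congrArg (fun st => I.A S ∩ st.free) (dependsOn_ideal_drop_compl_sampleCoin hi S h)

theorem measureReal_isLarge_and_card_lt_le (hI : Regular I) {i : ℕ}
    (hi : i + 1 ∈ Finset.Icc 1 I.stages) (n : ℕ) (S : ι) :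
    (coinMeasure I).real {ω | IsLarge I (choices I ω) (i + 1) (ideal I (choices I ω) i n) S ∧
      4 * ((I.A S ∩ (ideal I (choices I ω) i n).free).card : ℝ) < I.s / 2 ^ (i + 1)} ≤
      failProb I := by
  rcases sampleProb_eq_one_or hI (i + 1) with hp | hp
  · rw [show {ω | _} = (∅ : Set (Coin I → Bool)) from Set.eq_empty_of_forall_notMem ?_,
      measureReal_empty]
    · exact failProb_nonneg
    rintro ω ⟨hlarge, hfew⟩
    rw [isLarge_iff hI, hp, mul_one] at hlarge
    have hsample : (((choices I ω).B (i + 1) S ∩ (ideal I (choices I ω) i n).free).card : ℝ) ≤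
        (I.A S ∩ (ideal I (choices I ω) i n).free).card :=
      mod_cast Finset.card_le_card (Finset.inter_subset_inter_right (choices_proper ω (i + 1) S))
    linarith [Nat.cast_nonneg (α := ℝ) (I.A S ∩ (ideal I (choices I ω) i n).free).card]
  · have hN := dependsOn_inter_ideal_drop_compl_sampleCoin hi n S
    have htail := measureReal_and_le_card_filter_le (p := coinBias I) (sampleCoin_injective hi S)
      (φ := fun ω => 4 * ((I.A S ∩ (ideal I ((choices I ω).drop (i + 1) S) i n).free).card : ℝ) <
        I.s / 2 ^ (i + 1))
      (fun ω ω' h => by simp only [hN h]) hN (a := I.Λ ^ 5) (b := I.Λ ^ 5 / 2) fun ω hω => by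
        rw [sum_coinBias_sampleCoin hI]
        linarith [mul_lt_mul_of_pos_right hω (hI.sampleProb_pos (i + 1))]
    refine (measureReal_mono fun ω => ?_).trans
      (htail.trans (exp_sub_le_failProb (by linarith)))
    rintro ⟨hlarge, hfew⟩
    have hdrop := ideal_drop_of_not_disjoint (hlarge.not_disjoint hI (choices_proper ω))
    rw [isLarge_iff hI, hp, ← hdrop, B_inter_eq hi] at hlarge
    rw [← hdrop] at hfew
    exact ⟨hfew, hlarge⟩

theorem measureReal_lt_card_and_not_isLarge_le (hI : Regular I) {i : ℕ}
    (hi : i + 1 ∈ Finset.Icc 1 I.stages) (n : ℕ) (S : ι) :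
    (coinMeasure I).real {ω |
      4 * ((I.s : ℝ) / 2 ^ (i + 1)) < ((I.A S ∩ (ideal I (choices I ω) i n).free).card : ℝ) ∧
        ¬ IsLarge I (choices I ω) (i + 1) (ideal I (choices I ω) i n) S} ≤ failProb I := by
  have hscale : (0 : ℝ) ≤ I.s / 2 ^ (i + 1) := by positivity
  rcases sampleProb_eq_one_or hI (i + 1) with hp | hp
  · refine (measureReal_mono fun ω hω => ?_).trans
      ((measureReal_B_ne_eq_zero hI hi hp S).trans_le failProb_nonneg)
    intro hB
    refine hω.2 ?_
    rw [isLarge_iff hI, hp, mul_one, hB]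
    linarith [hω.1]
  · have hN := dependsOn_inter_ideal_drop_compl_sampleCoin hi n S
    have htail := measureReal_and_card_filter_le_le (p := coinBias I) (sampleCoin_injective hi S)
      (φ := fun ω => 4 * ((I.s : ℝ) / 2 ^ (i + 1)) <
        ((I.A S ∩ (ideal I ((choices I ω).drop (i + 1) S) i n).free).card : ℝ))
      (fun ω ω' h => by simp only [hN h]) hN (a := I.Λ ^ 5) (b := 2 * I.Λ ^ 5) fun ω hω => by
        rw [sum_coinBias_sampleCoin hI]
        linarith [mul_lt_mul_of_pos_right hω (hI.sampleProb_pos (i + 1))]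
    have hΛ := pow_pos hI.Λ_pos 5
    refine (measureReal_mono fun ω => ?_).trans
      (htail.trans (exp_sub_le_failProb (by linarith)))
    rintro ⟨hmany, hsmall⟩
    have hdrop := ideal_drop_of_not_disjoint
      (not_disjoint_of_lt_card_inter (mul_nonneg zero_le_four hscale) hmany)
    rw [isLarge_iff hI, hp, ← hdrop, B_inter_eq hi, not_le] at hsmall
    rw [← hdrop] at hmany
    exact ⟨hmany, hsmall.le⟩

theorem measureReal_lt_card_free_le (hI : Regular I) {i : ℕ} (hi : i ≤ I.stages) (S : ι) :
    (coinMeasure I).real {ω | 4 * ((I.s : ℝ) / 2 ^ i) <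
      ((I.A S ∩ (ideal I (choices I ω) i 0).free).card : ℝ)} ≤ failProb I := by
  rcases i with _ | i
  · rw [show {ω | _} = (∅ : Set (Coin I → Bool)) from Set.eq_empty_of_forall_notMem fun ω => ?_,
      measureReal_empty]
    · exact failProb_nonneg
    have hcard : ((I.A S ∩ (ideal I (choices I ω) 0 0).free).card : ℝ) ≤ I.s :=
      mod_cast (Finset.card_le_card Finset.inter_subset_left).trans (hI.card_le S)
    rw [Set.mem_ofPred_eq, pow_zero, div_one, not_lt]
    linarith [hI.s_pos]
  replace hi : i + 1 ∈ Finset.Icc 1 I.stages := Finset.mem_Icc.2 ⟨by omega, hi⟩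
  obtain ⟨L, hL⟩ := Nat.exists_eq_add_one.2 (iterations_pos hI)
  have hk : I.iterations ∈ Finset.Icc 1 I.iterations :=
    Finset.mem_Icc.2 ⟨iterations_pos hI, le_rfl⟩
  have hlast := measureReal_eq_false_eq_zero hI
    (show coinProb I (familyCoin hi hk S) = 1 from familyProb_iterations hI)
  refine (measureReal_le_add_of_imp_or fun ω hω => ?_).trans
    ((add_le_add hlast.le (measureReal_lt_card_and_not_isLarge_le hI hi L S)).trans_eq
      (zero_add _))
  have hscale : (0 : ℝ) ≤ 4 * (I.s / 2 ^ (i + 1)) := by positivity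
  rw [← ideal_iterations, hL] at hω
  -- The last family contains every set, so a set surviving the last iteration was not large.
  refine or_iff_not_imp_left.2 fun hcoin => ⟨hω.trans_le ?_, fun hlarge => ?_⟩
  · exact_mod_cast Finset.card_le_card
      (Finset.inter_subset_inter_left (ideal_free_antitone i (Nat.le_succ L)))
  · have hS : S ∈ (choices I ω).F (i + 1) (L + 1) := by
      rw [← hL, mem_choices_F hi hk]
      simpa using hcoin
    exact not_disjoint_of_lt_card_inter hscale hω
      (disjoint_ideal_free_of_isLarge hS hlarge (Nat.lt_succ_self L))

theorem measureReal_le_card_sample_le (hI : Regular I) (hΛ : 2 ≤ I.Λ) {i : ℕ}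
    (hi : i + 1 ∈ Finset.Icc 1 I.stages) (S : ι) :
    (coinMeasure I).real {ω | I.Λ ^ 10 ≤
      (((choices I ω).B (i + 1) S ∩ (ideal I (choices I ω) i 0).free).card : ℝ)} ≤
      2 * failProb I := by
  have hN : DependsOn (fun ω => I.A S ∩ (ideal I (choices I ω) i 0).free)
      (Set.range (sampleCoin (I := I) hi S))ᶜ := fun _ _ h =>
    congrArg (fun st => I.A S ∩ st.free) (dependsOn_ideal_zero_compl_sampleCoin hi S h)
  have htail := measureReal_and_le_card_filter_le (p := coinBias I) (sampleCoin_injective hi S)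
    (φ := fun ω => ((I.A S ∩ (ideal I (choices I ω) i 0).free).card : ℝ) ≤ 4 * (I.s / 2 ^ i))
    (fun ω ω' h => by simp only [hN h]) hN (a := I.Λ ^ 10) (b := 16 * I.Λ ^ 5) fun ω hω => by
      have hscale : (I.s : ℝ) / 2 ^ i = 2 * (I.s / 2 ^ (i + 1)) := by
        rw [pow_succ]; field_simp
      rw [hscale] at hω
      rw [sum_coinBias_sampleCoin hI]
      linarith [mul_le_mul_of_nonneg_right hω (hI.sampleProb_pos (i + 1)).le,
        scale_mul_sampleProb_le hI (i + 1)]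
  have hexp : Real.exp (16 * I.Λ ^ 5 - I.Λ ^ 10) ≤ failProb I :=
    exp_sub_le_failProb (by nlinarith [thirtyTwo_le_Λ_pow hΛ])
  rw [two_mul]
  refine (measureReal_le_add_of_imp_or fun ω hω => ?_).trans
    (add_le_add (measureReal_lt_card_free_le hI ((Nat.le_succ i).trans (Finset.mem_Icc.1 hi).2) S)
      (htail.trans hexp))
  rw [B_inter_eq hi] at hω
  exact (lt_or_ge _ _).imp id fun hfew => ⟨hfew, hω⟩

end FreeElements

section LargeSets

variable {ι E : Type*} [Fintype ι] [LinearOrder ι] [Fintype E] [DecidableEq E] {I : Input ι E}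

open scoped Classical in
/-- The sets that contain `e` and are large after `n` iterations of stage `i + 1` of the idealised
process. -/
noncomputable def largeSets (I : Input ι E) (c : Choices ι E) (i n : ℕ) (e : E) : Finset ι :=
  {S | IsLarge I c (i + 1) (ideal I c i n) S ∧ e ∈ I.A S}

theorem mem_largeSets {c : Choices ι E} {i n : ℕ} {e : E} {S : ι} :
    S ∈ largeSets I c i n e ↔ IsLarge I c (i + 1) (ideal I c i n) S ∧ e ∈ I.A S := by
  simp [largeSets]

theorem card_largeSets_le (hI : Regular I) (c : Choices ι E) (i n : ℕ) (e : E) :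
    (largeSets I c i n e).card ≤ I.t := by
  refine (Finset.card_le_card fun S hS => ?_).trans (hI.degree_le e)
  simpa using (mem_largeSets.1 hS).2

theorem largeSets_antitone (hI : Regular I) (c : Choices ι E) (i : ℕ) (e : E) :
    Antitone fun n => largeSets I c i n e := fun _ _ hnm _ hS =>
  mem_largeSets.2 ((mem_largeSets.1 hS).imp_left (.mono hI (ideal_free_antitone i hnm)))

theorem dependsOn_largeSets_compl_familyCoin {i k n : ℕ} (hi : i + 1 ∈ Finset.Icc 1 I.stages)
    (hk : k ∈ Finset.Icc 1 I.iterations) (hn : n < k) (e : E) :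
    DependsOn (fun ω => largeSets I (choices I ω) i n e)
      (Set.range (familyCoin (I := I) hi hk))ᶜ := by
  intro ω ω' h
  have hideal : ideal I (choices I ω) i n = ideal I (choices I ω') i n :=
    dependsOn_ideal_compl_familyCoin hi hk hn h
  have hB : (choices I ω).B = (choices I ω').B := dependsOn_B_compl_familyCoin hi hk h
  ext S
  rw [mem_largeSets, mem_largeSets]
  exact and_congr_left fun _ => isLarge_congr (by rw [hideal, hB])

theorem mem_ideal_free_succ_iff {i n : ℕ} (hi : i + 1 ∈ Finset.Icc 1 I.stages)
    (hk : n + 1 ∈ Finset.Icc 1 I.iterations) {ω : Coin I → Bool} {e : E} :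
    e ∈ (ideal I (choices I ω) i (n + 1)).free ↔ e ∈ (ideal I (choices I ω) i n).free ∧
      ∀ S ∈ largeSets I (choices I ω) i n e, ω (familyCoin hi hk S) = false := by
  simp only [mem_ideal_free_succ, mem_choices_F hi hk, mem_largeSets, ← Bool.not_eq_true]
  refine and_congr_right fun _ => forall_congr' fun S => ?_
  tauto

theorem measureReal_card_largeSets_le_and_le_card_le (hI : Regular I) (hΛ : 2 ≤ I.Λ)
    {i n k m : ℕ} (hi : i + 1 ∈ Finset.Icc 1 I.stages) (hk : k ∈ Finset.Icc 1 I.iterations)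
    (hm : k = n + 1 + m) (e : E) {thr : ℝ} (hthr : I.Λ ^ 10 * 2 ^ m ≤ thr) :
    (coinMeasure I).real {ω |
      ((largeSets I (choices I ω) i n e).card : ℝ) ≤ I.Λ ^ 5 * I.t / 2 ^ n ∧
        thr ≤ ({S ∈ largeSets I (choices I ω) i n e | ω (familyCoin hi hk S) = true}.card : ℝ)} ≤
      failProb I := by
  have ht := hI.t_pos
  have hN := dependsOn_largeSets_compl_familyCoin hi hk (show n < k by omega) e
  refine (measureReal_and_le_card_filter_le (p := coinBias I) (familyCoin_injective hi hk)
    (fun ω ω' h => by simp only [hN h]) hN (b := 4 * I.Λ ^ 5 * 2 ^ m) fun ω hω => ?_).trans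
      (exp_sub_le_failProb ?_)
  · rw [sum_coinBias_familyCoin hI]
    calc 2 * ((largeSets I (choices I ω) i n e).card * I.familyProb k)
        ≤ 2 * (I.Λ ^ 5 * I.t / 2 ^ n * (2 ^ k / I.t)) := by
          gcongr
          exacts [(hI.familyProb_pos k).le, familyProb_le k]
      _ = 4 * I.Λ ^ 5 * 2 ^ m := by
          rw [hm, pow_add, pow_succ]; field_simp; ring
  · have h32 := thirtyTwo_le_Λ_pow hΛ
    have hgap : I.Λ ^ 5 ≤ I.Λ ^ 10 - 4 * I.Λ ^ 5 := by nlinarith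
    have hscale : I.Λ ^ 10 - 4 * I.Λ ^ 5 ≤ (I.Λ ^ 10 - 4 * I.Λ ^ 5) * 2 ^ m :=
      le_mul_of_one_le_right (by linarith) (one_le_pow₀ one_le_two)
    linarith

theorem measureReal_lt_card_largeSets_and_forall_eq_false_le (hI : Regular I) {i n : ℕ}
    (hi : i + 1 ∈ Finset.Icc 1 I.stages) (hk : n + 1 ∈ Finset.Icc 1 I.iterations) (e : E) :
    (coinMeasure I).real {ω |
      I.Λ ^ 5 * I.t / 2 ^ (n + 1) < ((largeSets I (choices I ω) i n e).card : ℝ) ∧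
        ∀ S ∈ largeSets I (choices I ω) i n e, ω (familyCoin hi hk S) = false} ≤ failProb I := by
  have hN := dependsOn_largeSets_compl_familyCoin hi hk (Nat.lt_succ_self n) e
  refine measureReal_and_forall_eq_false_le (p := coinBias I) (familyCoin_injective hi hk)
    (fun ω ω' h => by simp only [hN h]) hN failProb_nonneg fun ω hω => ?_
  rw [prod_one_sub_coinBias_familyCoin hI]
  exact one_sub_familyProb_pow_le hI hω

/-- An element in many large sets would have been covered by the previous iteration, and one in few
of them is in few large sampled sets. -/
theorem measureReal_free_and_le_card_le (hI : Regular I) (hΛ : 2 ≤ I.Λ) {i n k m : ℕ}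
    (hi : i + 1 ∈ Finset.Icc 1 I.stages) (hk : k ∈ Finset.Icc 1 I.iterations)
    (hm : k = n + 1 + m) (e : E) {thr : ℝ} (hthr : I.Λ ^ 10 * 2 ^ m ≤ thr) :
    (coinMeasure I).real {ω | e ∈ (ideal I (choices I ω) i n).free ∧
      thr ≤ ({S ∈ largeSets I (choices I ω) i n e | ω (familyCoin hi hk S) = true}.card : ℝ)} ≤
      2 * failProb I := by
  have hfew := measureReal_card_largeSets_le_and_le_card_le hI hΛ hi hk hm e hthr
  rw [two_mul]
  rcases n with _ | n
  · refine (measureReal_mono fun ω hω => ?_).trans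
      (hfew.trans (le_add_of_nonneg_left failProb_nonneg))
    refine ⟨?_, hω.2⟩
    calc ((largeSets I (choices I ω) i 0 e).card : ℝ) ≤ I.t :=
          mod_cast card_largeSets_le hI _ _ _ _
      _ ≤ I.Λ ^ 5 * I.t := le_mul_of_one_le_left hI.t_pos.le (one_le_pow₀ hI.one_le_Λ)
      _ = I.Λ ^ 5 * I.t / 2 ^ 0 := by rw [pow_zero, div_one]
  · have hk' : n + 1 ∈ Finset.Icc 1 I.iterations := by
      rw [Finset.mem_Icc] at hk ⊢; omega
    refine (measureReal_le_add_of_imp_or fun ω hω => ?_).trans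
      (add_le_add hfew (measureReal_lt_card_largeSets_and_forall_eq_false_le hI hi hk' e))
    refine (le_or_gt _ _).imp (fun hcard => ⟨hcard, hω.2⟩) fun hcard =>
      ⟨hcard.trans_le ?_, ((mem_ideal_free_succ_iff hi hk').1 hω.1).2⟩
    exact_mod_cast Finset.card_le_card (largeSets_antitone hI _ i e (Nat.le_succ n))

end LargeSets

section DoubleCounting

variable {ι E : Type*} [DecidableEq E] {A : ι → Finset E}

theorem sum_elemDegree (A : ι → Finset E) (X : Finset ι) (U : Finset E) :
    ∑ e ∈ U, elemDegree A X e = ∑ S ∈ X, (A S ∩ U).card := by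
  simp only [elemDegree, Finset.inter_comm (A _), ← Finset.filter_mem_eq_inter]
  exact Finset.sum_card_bipartiteAbove_eq_sum_card_bipartiteBelow fun e S => e ∈ A S

variable [Fintype ι] [Fintype E]

theorem sum_le_sum_mul_of_isFractionalCover {x : ι → ℝ} (hx : IsFractionalCover A x)
    {f : E → ℝ} (hf : ∀ e, 0 ≤ f e) : ∑ e, f e ≤ ∑ S, x S * ∑ e ∈ A S, f e := by
  calc ∑ e, f e ≤ ∑ e, f e * ∑ S with e ∈ A S, x S :=
        Finset.sum_le_sum fun e _ => le_mul_of_one_le_right (hf e) (hx.2 e)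
    _ = ∑ e, ∑ S with e ∈ A S, x S * f e := by simp only [Finset.mul_sum, mul_comm]
    _ = ∑ S, ∑ e ∈ A S, x S * f e := Finset.sum_comm' (by simp)
    _ = ∑ S, x S * ∑ e ∈ A S, f e := by simp only [Finset.mul_sum]

variable {I : Input ι E}

theorem card_nonempty_le (hI : Regular I) :
    (({S | (I.A S).Nonempty} : Finset ι).card : ℝ) ≤ I.t * Fintype.card E := by
  have hcard : ({S | (I.A S).Nonempty} : Finset ι).card ≤ ∑ S, (I.A S).card := by
    rw [Finset.card_filter]
    refine Finset.sum_le_sum fun S _ => ?_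
    split_ifs with h
    exacts [Finset.card_pos.2 h, Nat.zero_le _]
  have hdegree := sum_elemDegree I.A Finset.univ Finset.univ
  simp only [Finset.inter_univ] at hdegree
  rw [← hdegree] at hcard
  rw [mul_comm]
  exact_mod_cast hcard.trans (Finset.sum_le_card_nsmul _ _ _ fun e _ => hI.degree_le e)

theorem card_le_mul_sum (hI : Regular I) {x : ι → ℝ} (hx : IsFractionalCover I.A x) :
    (Fintype.card E : ℝ) ≤ I.s * ∑ S, x S := by
  calc (Fintype.card E : ℝ) = ∑ _e : E, 1 := by simp
    _ ≤ ∑ S, x S * ∑ _e ∈ I.A S, 1 :=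
        sum_le_sum_mul_of_isFractionalCover hx fun _ => zero_le_one
    _ = ∑ S, x S * (I.A S).card := by simp
    _ ≤ ∑ S, x S * I.s := by
        gcongr with S
        exacts [hx.1 S, hI.card_le S]
    _ = I.s * ∑ S, x S := by rw [← Finset.sum_mul, mul_comm]

end DoubleCounting

section AddedSets

variable {ι E : Type*} [LinearOrder ι] [Fintype E] [DecidableEq E] {I : Input ι E}

open scoped Classical in
/-- The sets added in iteration `n + 1` of stage `i + 1` of the idealised process. -/
noncomputable def addedSets (I : Input ι E) (c : Choices ι E) (i n : ℕ) : Finset ι :=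
  {S ∈ c.F (i + 1) (n + 1) | IsLarge I c (i + 1) (ideal I c i n) S}

theorem mem_addedSets {c : Choices ι E} {i n : ℕ} {S : ι} :
    S ∈ addedSets I c i n ↔
      S ∈ c.F (i + 1) (n + 1) ∧ IsLarge I c (i + 1) (ideal I c i n) S := by
  simp only [addedSets, Finset.mem_filter]

theorem card_ideal_cover_le (c : Choices ι E) (m : ℕ) :
    (ideal I c m 0).cover.card ≤
      ∑ i ∈ Finset.range m, ∑ n ∈ Finset.range I.iterations, (addedSets I c i n).card := by
  have hstage (i n : ℕ) : (ideal I c i n).cover.card ≤ (ideal I c i 0).cover.card +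
      ∑ k ∈ Finset.range n, (addedSets I c i k).card := by
    induction n with
    | zero => simp
    | succ n ih =>
      rw [Finset.sum_range_succ, ← add_assoc]
      exact (Finset.card_union_le _ _).trans (Nat.add_le_add_right ih _)
  induction m with
  | zero => simp [ideal, idealStage, idealStart]
  | succ m ih =>
    rw [Finset.sum_range_succ, ← ideal_iterations]
    exact (hstage m _).trans (Nat.add_le_add_right ih _)

end AddedSets

section FreeProb

variable {ι E : Type*} [Fintype ι] [LinearOrder ι] [Fintype E] [DecidableEq E] {I : Input ι E}

/-- The probability that `e` is free after `n` iterations of stage `i + 1` of the idealised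
process. -/
noncomputable def freeProb (I : Input ι E) (i n : ℕ) (e : E) : ℝ :=
  (coinMeasure I).real {ω | e ∈ (ideal I (choices I ω) i n).free}

theorem freeProb_nonneg (i n : ℕ) (e : E) : 0 ≤ freeProb I i n e := measureReal_nonneg

theorem freeProb_eq_integral (i n : ℕ) (e : E) :
    freeProb I i n e =
      ∫ ω, (if e ∈ (ideal I (choices I ω) i n).free then 1 else 0) ∂coinMeasure I :=
  (integral_ite_one_zero _).symm

theorem sum_mem_freeProb_le (hI : Regular I) {i : ℕ} (hi : i ≤ I.stages) (S : ι) :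
    ∑ e ∈ I.A S, freeProb I i 0 e ≤ 4 * (I.s / 2 ^ i) + I.s * failProb I := by
  classical
  set many : (Coin I → Bool) → Prop := fun ω => 4 * ((I.s : ℝ) / 2 ^ i) <
    ((I.A S ∩ (ideal I (choices I ω) i 0).free).card : ℝ)
  have hpointwise (ω) : ((I.A S ∩ (ideal I (choices I ω) i 0).free).card : ℝ) ≤
      4 * (I.s / 2 ^ i) + I.s * if many ω then 1 else 0 := by
    by_cases h : many ω
    · rw [if_pos h]
      have hcard : ((I.A S ∩ (ideal I (choices I ω) i 0).free).card : ℝ) ≤ I.s :=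
        mod_cast (Finset.card_le_card Finset.inter_subset_left).trans (hI.card_le S)
      have : (0 : ℝ) ≤ 4 * ((I.s : ℝ) / 2 ^ i) := by positivity
      linarith
    · rw [if_neg h]
      linarith [not_lt.1 h]
  calc ∑ e ∈ I.A S, freeProb I i 0 e
      = ∫ ω, ((I.A S ∩ (ideal I (choices I ω) i 0).free).card : ℝ) ∂coinMeasure I := by
        simp only [freeProb_eq_integral]
        rw [← integral_finsetSum _ fun _ _ => .of_finite]
        simp only [Finset.sum_boole, Finset.filter_mem_eq_inter]
    _ ≤ ∫ ω, (4 * ((I.s : ℝ) / 2 ^ i) + I.s * if many ω then 1 else 0) ∂coinMeasure I :=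
        integral_mono .of_finite .of_finite hpointwise
    _ = 4 * (I.s / 2 ^ i) + I.s * (coinMeasure I).real {ω | many ω} := by
        rw [integral_add .of_finite .of_finite, integral_const, integral_const_mul,
          integral_ite_one_zero, probReal_univ, one_smul]
    _ ≤ 4 * (I.s / 2 ^ i) + I.s * failProb I := by
        gcongr
        exact measureReal_lt_card_free_le hI hi S

theorem sum_freeProb_le (hI : Regular I) {x : ι → ℝ} (hx : IsFractionalCover I.A x) {i : ℕ}
    (hi : i ≤ I.stages) :
    ∑ e, freeProb I i 0 e ≤ (4 * (I.s / 2 ^ i) + I.s * failProb I) * ∑ S, x S := by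
  refine (sum_le_sum_mul_of_isFractionalCover hx (freeProb_nonneg i 0)).trans ?_
  rw [mul_comm, Finset.sum_mul]
  gcongr with S
  exacts [hx.1 S, sum_mem_freeProb_le hI hi S]

theorem integral_ideal_free_succ {i n : ℕ} (hI : Regular I)
    (hi : i + 1 ∈ Finset.Icc 1 I.stages) (hk : n + 1 ∈ Finset.Icc 1 I.iterations) (e : E)
    (f : ℕ → ℝ) :
    ∫ ω, (if e ∈ (ideal I (choices I ω) i (n + 1)).free
        then f (largeSets I (choices I ω) i n e).card else 0) ∂coinMeasure I =
      ∫ ω, (if e ∈ (ideal I (choices I ω) i n).free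
        then f (largeSets I (choices I ω) i n e).card *
          (1 - I.familyProb (n + 1)) ^ (largeSets I (choices I ω) i n e).card
        else 0) ∂coinMeasure I := by
  have hfree := dependsOn_ideal_compl_familyCoin hi hk (Nat.lt_succ_self n)
  have hN := dependsOn_largeSets_compl_familyCoin hi hk (Nat.lt_succ_self n) e
  have hresample := integral_mul_forall_eq_false (p := coinBias I) (familyCoin_injective hi hk)
    (φ := fun ω => if e ∈ (ideal I (choices I ω) i n).free
      then f (largeSets I (choices I ω) i n e).card else 0)
    (fun ω ω' h => by simp only [hfree h, hN h]) hN
  simpa only [coinMeasure_eq, mem_ideal_free_succ_iff hi hk, prod_one_sub_coinBias_familyCoin hI,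
    mul_boole, ite_zero_mul, ← ite_and, and_comm] using hresample

theorem freeProb_succ_eq (hI : Regular I) {i n : ℕ} (hi : i + 1 ∈ Finset.Icc 1 I.stages)
    (hk : n + 1 ∈ Finset.Icc 1 I.iterations) (e : E) :
    freeProb I i (n + 1) e = ∫ ω, (if e ∈ (ideal I (choices I ω) i n).free
      then (1 - I.familyProb (n + 1)) ^ (largeSets I (choices I ω) i n e).card
      else 0) ∂coinMeasure I := by
  rw [freeProb_eq_integral, integral_ideal_free_succ hI hi hk e fun _ => 1]
  simp only [one_mul]

end FreeProb

section Load

variable {ι E : Type*} [Fintype ι] [LinearOrder ι] [Fintype E] [DecidableEq E] {I : Input ι E}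

/-- The expected number of sets containing `e` that are added in iteration `n + 1` of stage `i + 1`
of the idealised process while `e` is free. -/
noncomputable def load (I : Input ι E) (i n : ℕ) (e : E) : ℝ :=
  ∫ ω, (if e ∈ (ideal I (choices I ω) i n).free
    then (elemDegree I.A (addedSets I (choices I ω) i n) e : ℝ) else 0) ∂coinMeasure I

theorem load_eq (hI : Regular I) {i n : ℕ} (hi : i + 1 ∈ Finset.Icc 1 I.stages)
    (hk : n + 1 ∈ Finset.Icc 1 I.iterations) (e : E) :
    load I i n e = ∫ ω, (if e ∈ (ideal I (choices I ω) i n).free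
      then ((largeSets I (choices I ω) i n e).card : ℝ) * I.familyProb (n + 1)
      else 0) ∂coinMeasure I := by
  have hfree := dependsOn_ideal_compl_familyCoin hi hk (Nat.lt_succ_self n)
  have hN := dependsOn_largeSets_compl_familyCoin hi hk (Nat.lt_succ_self n) e
  have hresample := integral_mul_card_filter_eq_true (p := coinBias I)
    (familyCoin_injective hi hk)
    (φ := fun ω => if e ∈ (ideal I (choices I ω) i n).free then 1 else 0)
    (fun ω ω' h => by simp only [hfree h]) hN
  have hdegree (ω) : elemDegree I.A (addedSets I (choices I ω) i n) e =
      {S ∈ largeSets I (choices I ω) i n e | ω (familyCoin hi hk S) = true}.card := by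
    refine congrArg Finset.card ?_
    ext S
    simp only [Finset.mem_filter, mem_addedSets, mem_largeSets, mem_choices_F hi hk]
    tauto
  simpa only [load, hdegree, coinMeasure_eq, sum_coinBias_familyCoin hI, ite_mul, zero_mul,
    one_mul] using hresample

theorem load_zero_le (hI : Regular I) {i : ℕ} (hi : i + 1 ∈ Finset.Icc 1 I.stages)
    (hk : 0 + 1 ∈ Finset.Icc 1 I.iterations) (e : E) :
    load I i 0 e ≤ 2 * freeProb I i 0 e := by
  have ht := hI.t_pos
  rw [load_eq hI hi hk, freeProb_eq_integral, ← integral_const_mul]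
  refine integral_mono .of_finite .of_finite fun ω => ?_
  dsimp only
  split_ifs
  · calc ((largeSets I (choices I ω) i 0 e).card : ℝ) * I.familyProb (0 + 1)
        ≤ I.t * (2 ^ (0 + 1) / I.t) := by
          gcongr
          exacts [(hI.familyProb_pos _).le, card_largeSets_le hI _ _ _ _, familyProb_le _]
      _ = 2 * 1 := by field_simp; norm_num
  · simp

/-- Conditioned on the large sets before iteration `n + 1`, the element `e` is in `d` of them and
stays free with probability `(1 - q) ^ d`, so it pays `q * d * (1 - q) ^ d` for the next iteration;
this is at most the probability `1 - (1 - q) ^ d` that it stops being free. -/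
theorem load_succ_le (hI : Regular I) {i n : ℕ} (hi : i + 1 ∈ Finset.Icc 1 I.stages)
    (hk : n + 1 + 1 ∈ Finset.Icc 1 I.iterations) (e : E) :
    load I i (n + 1) e ≤ 2 * (freeProb I i n e - freeProb I i (n + 1) e) := by
  have hk' : n + 1 ∈ Finset.Icc 1 I.iterations := by
    rw [Finset.mem_Icc] at hk ⊢; omega
  set q := I.familyProb (n + 1) with hq
  have hq_pos : 0 < q := hI.familyProb_pos _
  calc load I i (n + 1) e
      ≤ ∫ ω, 2 * (if e ∈ (ideal I (choices I ω) i (n + 1)).free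
          then (largeSets I (choices I ω) i n e).card * q else 0) ∂coinMeasure I := by
        rw [load_eq hI hi hk]
        refine integral_mono .of_finite .of_finite fun ω => ?_
        dsimp only
        split_ifs
        · rw [mul_left_comm]
          gcongr
          exacts [(hI.familyProb_pos _).le, largeSets_antitone hI _ i e (Nat.le_succ n),
            familyProb_succ_le _]
        · rw [mul_zero]
    _ = 2 * ∫ ω, (if e ∈ (ideal I (choices I ω) i n).free
          then (largeSets I (choices I ω) i n e).card * q *
            (1 - q) ^ (largeSets I (choices I ω) i n e).card else 0) ∂coinMeasure I := by
        rw [integral_const_mul, integral_ideal_free_succ hI hi hk' e fun d => d * q]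
    _ ≤ 2 * (freeProb I i n e - freeProb I i (n + 1) e) := by
        rw [freeProb_succ_eq hI hi hk', freeProb_eq_integral, ← integral_sub .of_finite .of_finite]
        refine mul_le_mul_of_nonneg_left (integral_mono .of_finite .of_finite fun ω => ?_)
          zero_le_two
        dsimp only
        split_ifs
        exacts [mul_one_sub_pow_le hq_pos.le (min_le_left _ _) _, (sub_zero _).ge]

theorem sum_load_le (hI : Regular I) {i : ℕ} (hi : i + 1 ∈ Finset.Icc 1 I.stages) (e : E) :
    ∑ n ∈ Finset.range I.iterations, load I i n e ≤ 4 * freeProb I i 0 e := by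
  have htelescope (m : ℕ) (hm : m + 1 ≤ I.iterations) :
      ∑ n ∈ Finset.range (m + 1), load I i n e ≤
        4 * freeProb I i 0 e - 2 * freeProb I i m e := by
    induction m with
    | zero =>
      rw [Finset.sum_range_one]
      linarith [load_zero_le hI hi (Finset.mem_Icc.2 ⟨le_rfl, hm⟩) e]
    | succ m ih =>
      rw [Finset.sum_range_succ]
      linarith [load_succ_le hI hi (Finset.mem_Icc.2 ⟨by omega, hm⟩) e, ih (by omega)]
  obtain ⟨L, hL⟩ := Nat.exists_eq_add_one.2 (iterations_pos hI)
  rw [hL]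
  linarith [htelescope L hL.ge, freeProb_nonneg (I := I) i L e]

end Load

section IdealSize

variable {ι E : Type*} [Fintype ι] [LinearOrder ι] [Fintype E] [DecidableEq E] {I : Input ι E}

open scoped Classical in
/-- Unless its estimate is far off, an added set has a quarter of the scale in free elements, so
it can be charged to them. -/
theorem card_addedSets_le (hI : Regular I) {c : Choices ι E} (hc : c.Proper I) (i n : ℕ) :
    ((addedSets I c i n).card : ℝ) ≤
      (∑ S with (I.A S).Nonempty, if IsLarge I c (i + 1) (ideal I c i n) S ∧
        4 * ((I.A S ∩ (ideal I c i n).free).card : ℝ) < I.s / 2 ^ (i + 1) then 1 else 0) +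
      4 * (2 ^ (i + 1) / I.s) *
        ∑ e ∈ (ideal I c i n).free, (elemDegree I.A (addedSets I c i n) e : ℝ) := by
  have hs := hI.s_pos
  set U := (ideal I c i n).free
  have hone (S) (hS : S ∈ addedSets I c i n) : (1 : ℝ) ≤
      (if IsLarge I c (i + 1) (ideal I c i n) S ∧
        4 * ((I.A S ∩ U).card : ℝ) < I.s / 2 ^ (i + 1) then 1 else 0) +
        4 * (2 ^ (i + 1) / I.s) * (I.A S ∩ U).card := by
    split_ifs with h
    · exact le_add_of_nonneg_right (by positivity)
    · simp only [(mem_addedSets.1 hS).2, true_and, not_lt] at h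
      calc (1 : ℝ) = 2 ^ (i + 1) / I.s * (I.s / 2 ^ (i + 1)) := by field_simp
        _ ≤ 2 ^ (i + 1) / I.s * (4 * (I.A S ∩ U).card) := by gcongr
        _ = 0 + 4 * (2 ^ (i + 1) / I.s) * (I.A S ∩ U).card := by ring
  have hnonempty : addedSets I c i n ⊆ ({S | (I.A S).Nonempty} : Finset ι) := fun S hS =>
    Finset.mem_filter.2 ⟨Finset.mem_univ S, (((mem_addedSets.1 hS).2.nonempty hI).mono
      Finset.inter_subset_left).mono (hc _ _)⟩
  have hdouble : ∑ e ∈ U, (elemDegree I.A (addedSets I c i n) e : ℝ) =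
      ∑ S ∈ addedSets I c i n, ((I.A S ∩ U).card : ℝ) := mod_cast sum_elemDegree _ _ _
  rw [hdouble, Finset.mul_sum, Finset.cast_card]
  refine (Finset.sum_le_sum hone).trans ?_
  rw [Finset.sum_add_distrib]
  gcongr

theorem integral_card_addedSets_le (hI : Regular I) {i : ℕ}
    (hi : i + 1 ∈ Finset.Icc 1 I.stages) (n : ℕ) :
    ∫ ω, ((addedSets I (choices I ω) i n).card : ℝ) ∂coinMeasure I ≤
      I.t * Fintype.card E * failProb I + 4 * (2 ^ (i + 1) / I.s) * ∑ e, load I i n e := by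
  classical
  refine (integral_mono .of_finite .of_finite fun ω =>
    card_addedSets_le hI (choices_proper ω) i n).trans ?_
  rw [integral_add .of_finite .of_finite, integral_const_mul,
    integral_finsetSum _ fun _ _ => .of_finite]
  simp only [integral_ite_one_zero]
  gcongr ?_ + _ * ?_
  · calc _ ≤ (({S | (I.A S).Nonempty} : Finset ι).card : ℝ) * failProb I := by
          rw [← nsmul_eq_mul]
          exact Finset.sum_le_card_nsmul _ _ _ fun S _ =>
            measureReal_isLarge_and_card_lt_le hI hi n S
      _ ≤ I.t * Fintype.card E * failProb I :=
          mul_le_mul_of_nonneg_right (card_nonempty_le hI) failProb_nonneg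
  · simp only [load]
    rw [← integral_finsetSum _ fun _ _ => .of_finite]
    simp only [← Finset.sum_filter, Finset.filter_univ_mem, le_refl]

theorem sum_integral_card_addedSets_le (hI : Regular I) {x : ι → ℝ}
    (hx : IsFractionalCover I.A x) {i : ℕ} (hi : i < I.stages) :
    ∑ n ∈ Finset.range I.iterations, ∫ ω, ((addedSets I (choices I ω) i n).card : ℝ) ∂coinMeasure I
      ≤ I.iterations * (I.t * Fintype.card E * failProb I) +
        (128 + 16 * 2 ^ (i + 1) * failProb I) * ∑ S, x S := by
  have hs := hI.s_pos
  have hi' : i + 1 ∈ Finset.Icc 1 I.stages := Finset.mem_Icc.2 ⟨by omega, hi⟩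
  refine (Finset.sum_le_sum fun n _ => integral_card_addedSets_le hI hi' n).trans ?_
  rw [Finset.sum_add_distrib, Finset.sum_const, Finset.card_range, nsmul_eq_mul,
    ← Finset.mul_sum, Finset.sum_comm]
  gcongr ?_ + ?_
  · rfl
  calc 4 * (2 ^ (i + 1) / (I.s : ℝ)) * ∑ e, ∑ n ∈ Finset.range I.iterations, load I i n e
      ≤ 4 * (2 ^ (i + 1) / (I.s : ℝ)) * (4 * ∑ e, freeProb I i 0 e) := by
        rw [Finset.mul_sum (f := freeProb I i 0)]
        gcongr with e
        exact sum_load_le hI hi' e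
    _ ≤ 4 * (2 ^ (i + 1) / (I.s : ℝ)) *
          (4 * ((4 * (I.s / 2 ^ i) + I.s * failProb I) * ∑ S, x S)) := by
        gcongr
        exact sum_freeProb_le hI hx hi.le
    _ = (128 + 16 * 2 ^ (i + 1) * failProb I) * ∑ S, x S := by
        rw [pow_succ]; field_simp; ring

theorem integral_card_ideal_cover_le (hI : Regular I) {x : ι → ℝ}
    (hx : IsFractionalCover I.A x) :
    ∫ ω, ((ideal I (choices I ω) I.stages 0).cover.card : ℝ) ∂coinMeasure I ≤
      I.stages * (I.iterations * (I.t * Fintype.card E * failProb I) +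
        (128 + 16 * 2 ^ I.stages * failProb I) * ∑ S, x S) := by
  have hX : 0 ≤ ∑ S, x S := Finset.sum_nonneg fun S _ => hx.1 S
  have hfail := failProb_nonneg (I := I)
  calc ∫ ω, ((ideal I (choices I ω) I.stages 0).cover.card : ℝ) ∂coinMeasure I
      ≤ ∫ ω, ∑ i ∈ Finset.range I.stages, ∑ n ∈ Finset.range I.iterations,
          ((addedSets I (choices I ω) i n).card : ℝ) ∂coinMeasure I :=
        integral_mono .of_finite .of_finite fun ω => by
          dsimp only
          exact_mod_cast card_ideal_cover_le (choices I ω) I.stages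
    _ = ∑ i ∈ Finset.range I.stages, ∑ n ∈ Finset.range I.iterations,
          ∫ ω, ((addedSets I (choices I ω) i n).card : ℝ) ∂coinMeasure I := by
        rw [integral_finsetSum _ fun _ _ => .of_finite]
        exact Finset.sum_congr rfl fun i _ => integral_finsetSum _ fun _ _ => .of_finite
    _ ≤ ∑ i ∈ Finset.range I.stages, (I.iterations * (I.t * Fintype.card E * failProb I) +
          (128 + 16 * 2 ^ I.stages * failProb I) * ∑ S, x S) := by
        refine Finset.sum_le_sum fun i hi => ?_
        rw [Finset.mem_range] at hi
        refine (sum_integral_card_addedSets_le hI hx hi).trans ?_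
        gcongr
        exacts [one_le_two, hi]
    _ = _ := by rw [Finset.sum_const, Finset.card_range, nsmul_eq_mul]

end IdealSize

section Procedures

variable {ι E : Type*} [DecidableEq E] {I : Input ι E} {c : Choices ι E}

theorem sparsify_succ (i : ℕ) (thr : ℕ → ℝ) (k₀ n : ℕ) (G : ℕ → Finset ι) (st : State ι E) :
    sparsify I c i thr k₀ (n + 1) G st =
      sparsifyStep I c i thr (sparsify I c i thr k₀ n G st) (k₀ + n) := by
  rw [sparsify, List.range'_1_concat, List.foldl_append]
  rfl

theorem sparsifyStep_free_subset (i : ℕ) (thr : ℕ → ℝ) (x : (ℕ → Finset ι) × State ι E) (k : ℕ) :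
    (sparsifyStep I c i thr x k).2.free ⊆ x.2.free := Finset.sdiff_subset

theorem sparsify_free_subset (i : ℕ) (thr : ℕ → ℝ) (k₀ n : ℕ) (G : ℕ → Finset ι)
    (st : State ι E) : (sparsify I c i thr k₀ n G st).2.free ⊆ st.free := by
  induction n with
  | zero => exact subset_rfl
  | succ n ih =>
    rw [sparsify_succ]
    exact (sparsifyStep_free_subset ..).trans ih

variable [LinearOrder ι]

open scoped Classical in
theorem baseCase_succ (i k₀ n : ℕ) (G : ℕ → Finset ι) (st : State ι E) :
    baseCase I c i k₀ (n + 1) G st = (baseCase I c i k₀ n G st).addSets I.A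
      {S ∈ G (k₀ + n) | S ∉ (baseCase I c i k₀ n G st).cover ∧
        IsLarge I c i (baseCase I c i k₀ n G st) S} := by
  rw [baseCase, List.range'_1_concat, List.foldl_append]
  rfl

theorem baseCase_free_subset (i k₀ n : ℕ) (G : ℕ → Finset ι) (st : State ι E) :
    (baseCase I c i k₀ n G st).free ⊆ st.free := by
  induction n with
  | zero => exact subset_rfl
  | succ n ih =>
    rw [baseCase_succ]
    exact Finset.sdiff_subset.trans ih

theorem recSplit_free_subset (i k₀ R : ℕ) (G : ℕ → Finset ι) (st : State ι E) :
    (recSplit I c i k₀ R G st).free ⊆ st.free := by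
  induction R using Nat.strong_induction_on generalizing k₀ G st with
  | _ R ih =>
    rw [recSplit]
    split_ifs with hR
    · exact baseCase_free_subset ..
    · have : 1 < R := not_le.1 (not_or.1 hR).1
      exact ((ih (R - R / 2) (by omega) ..).trans (sparsify_free_subset ..)).trans
        (ih (R / 2) (by omega) ..)

variable [Fintype ι] [Fintype E]

/-- The state of the algorithm after `n` stages. -/
noncomputable def afterStages (I : Input ι E) (c : Choices ι E) (n : ℕ) : State ι E :=
  (List.range' 1 n).foldl (stage I c) ⟨∅, Finset.univ⟩

theorem afterStages_succ (n : ℕ) :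
    afterStages I c (n + 1) = stage I c (afterStages I c n) (n + 1) := by
  rw [afterStages, List.range'_1_concat, List.foldl_append, add_comm 1 n]
  rfl

theorem solution_eq (ω : Coin I → Bool) :
    solution I ω = (afterStages I (choices I ω) I.stages).cover ∪
      cleanUp I.A (afterStages I (choices I ω) I.stages).cover := rfl

end Procedures

section Tracks

variable {ι E : Type*} [DecidableEq E] {I : Input ι E} {c : Choices ι E} {i : ℕ}

/-- In the iterations `k₀, …, k₀ + R - 1` of stage `i`, the family `G k` consists of sets of
`S_{i,k}`, among them all those that are currently large. This is what is left of `S_{i,k}` after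
any number of sparsification steps. -/
def Tracks (I : Input ι E) (c : Choices ι E) (i : ℕ) (G : ℕ → Finset ι) (st : State ι E)
    (k₀ R : ℕ) : Prop :=
  ∀ k, k₀ ≤ k → k < k₀ + R → G k ⊆ c.F i k ∧ ∀ S ∈ c.F i k, IsLarge I c i st S → S ∈ G k

variable [Fintype ι]

theorem Tracks.mono (hI : Regular I) {G : ℕ → Finset ι} {st st' : State ι E} {k₀ R k₀' R' : ℕ}
    (h : Tracks I c i G st k₀ R) (hst : st'.free ⊆ st.free) (hk : k₀ ≤ k₀')
    (hR : k₀' + R' ≤ k₀ + R) : Tracks I c i G st' k₀' R' := by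
  intro k hk₀ hkR
  obtain ⟨hsub, hlarge⟩ := h k (by omega) (by omega)
  exact ⟨hsub, fun S hS hl => hlarge S hS (hl.mono hI hst)⟩

theorem tracks_sparsifyStep (hI : Regular I) {x : (ℕ → Finset ι) × State ι E} {k₀ R : ℕ}
    (h : Tracks I c i x.1 x.2 k₀ R) (thr : ℕ → ℝ) (k : ℕ) :
    Tracks I c i (sparsifyStep I c i thr x k).1 (sparsifyStep I c i thr x k).2 k₀ R := by
  classical
  refine Tracks.mono hI (fun k' hk₀ hkR => ?_) (sparsifyStep_free_subset i thr x k) le_rfl le_rfl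
  obtain ⟨hsub, hlarge⟩ := h k' hk₀ hkR
  by_cases hk : k' = k
  · subst hk
    simp only [sparsifyStep, Function.update_self, Finset.mem_filter]
    exact ⟨(Finset.filter_subset _ _).trans hsub, fun S hS hl => ⟨hlarge S hS hl, hl⟩⟩
  · simpa only [sparsifyStep, Function.update_of_ne hk] using ⟨hsub, hlarge⟩

theorem tracks_sparsify (hI : Regular I) {G : ℕ → Finset ι} {st : State ι E} {k₀ R : ℕ}
    (h : Tracks I c i G st k₀ R) (thr : ℕ → ℝ) (k n : ℕ) :
    Tracks I c i (sparsify I c i thr k n G st).1 (sparsify I c i thr k n G st).2 k₀ R := by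
  induction n with
  | zero => exact h
  | succ n ih =>
    rw [sparsify_succ]
    exact tracks_sparsifyStep hI ih thr _

end Tracks

section Clean

variable {ι E : Type*} [DecidableEq E] {I : Input ι E} {c : Choices ι E} {st : State ι E}

/-- The sets of the cover are nonempty and have no free elements; an invariant of the algorithm. -/
def State.Clean (I : Input ι E) (st : State ι E) : Prop :=
  ∀ S ∈ st.cover, (I.A S).Nonempty ∧ Disjoint (I.A S) st.free

theorem State.Clean.pretend (h : st.Clean I) (Y : Finset E) : (st.pretend Y).Clean I :=
  fun S hS => ⟨(h S hS).1, (h S hS).2.mono_right Finset.sdiff_subset⟩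

theorem clean_sparsify (h : st.Clean I) (i : ℕ) (thr : ℕ → ℝ) (k₀ n : ℕ) (G : ℕ → Finset ι) :
    (sparsify I c i thr k₀ n G st).2.Clean I := by
  induction n with
  | zero => exact h
  | succ n ih =>
    rw [sparsify_succ]
    exact ih.pretend _

variable [LinearOrder ι]

theorem State.Clean.addSets (h : st.Clean I) {X : Finset ι} (hX : ∀ S ∈ X, (I.A S).Nonempty) :
    (st.addSets I.A X).Clean I := by
  intro S hS
  rcases Finset.mem_union.1 hS with hS | hS
  · exact ⟨(h S hS).1, (h S hS).2.mono_right Finset.sdiff_subset⟩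
  · exact ⟨hX S hS, Finset.disjoint_left.2 fun e he hf => (mem_addSets_free.1 hf).2 S hS he⟩

variable [Fintype ι]

theorem clean_baseCase (hI : Regular I) (hc : c.Proper I) (h : st.Clean I) (i k₀ n : ℕ)
    (G : ℕ → Finset ι) : (baseCase I c i k₀ n G st).Clean I := by
  induction n with
  | zero => exact h
  | succ n ih =>
    rw [baseCase_succ]
    refine ih.addSets fun S hS => ?_
    simp only [Finset.mem_filter] at hS
    exact (hS.2.2.nonempty hI).mono (Finset.inter_subset_left.trans (hc _ _))

theorem clean_recSplit (hI : Regular I) (hc : c.Proper I) (h : st.Clean I) (i k₀ R : ℕ)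
    (G : ℕ → Finset ι) : (recSplit I c i k₀ R G st).Clean I := by
  induction R using Nat.strong_induction_on generalizing k₀ G st with
  | _ R ih =>
    rw [recSplit]
    split_ifs with hR
    · exact clean_baseCase hI hc h _ _ _ _
    · have : 1 < R := not_le.1 (not_or.1 hR).1
      exact ih (R - R / 2) (by omega)
        (clean_sparsify (ih (R / 2) (by omega) h _ _) _ _ _ _ _) _ _

theorem clean_addSets_of_le_card (hI : Regular I) (hc : c.Proper I) (h : st.Clean I) {i : ℕ}
    {X : Finset ι} (hX : ∀ S ∈ X, I.Λ ^ 10 ≤ ((c.B i S ∩ st.free).card : ℝ)) :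
    (st.addSets I.A X).Clean I := by
  refine h.addSets fun S hS => ?_
  have hpos := (pow_pos hI.Λ_pos 10).trans_le (hX S hS)
  rw [Nat.cast_pos, Finset.card_pos] at hpos
  exact hpos.mono (Finset.inter_subset_left.trans (hc _ _))

theorem clean_stage (hI : Regular I) (hc : c.Proper I) (h : st.Clean I) (i : ℕ) :
    (stage I c st i).Clean I :=
  clean_recSplit hI hc (clean_sparsify (clean_addSets_of_le_card hI hc h fun _ hS =>
    (Finset.mem_filter.1 hS).2) _ _ _ _ _) _ _ _ _

variable [Fintype E]

theorem clean_afterStages (hI : Regular I) (hc : c.Proper I) (n : ℕ) :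
    (afterStages I c n).Clean I := by
  induction n with
  | zero => exact fun S hS => absurd hS (Finset.notMem_empty S)
  | succ n ih =>
    rw [afterStages_succ]
    exact clean_stage hI hc ih _

end Clean

section CleanUp

variable {ι E : Type*} [Fintype ι] [LinearOrder ι] [Fintype E] [DecidableEq E]
  {A : ι → Finset E} {I : Input ι E}

theorem mem_cleanUp {X : Finset ι} {S : ι} :
    S ∈ cleanUp A X ↔ ∃ e, (∀ S' ∈ X, e ∉ A S') ∧ e ∈ A S ∧ ∀ S', e ∈ A S' → S ≤ S' := by
  simp only [cleanUp, Finset.mem_filter_univ]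

theorem isSetCover_union_cleanUp (hA : ∀ e, ∃ S, e ∈ A S) (X : Finset ι) :
    IsSetCover A (X ∪ cleanUp A X) := by
  intro e
  by_cases he : ∃ S ∈ X, e ∈ A S
  · obtain ⟨S, hS, heS⟩ := he
    exact ⟨S, Finset.mem_union_left _ hS, heS⟩
  · push Not at he
    obtain ⟨S, heS, hmin⟩ := WellFounded.has_min wellFounded_lt {S | e ∈ A S} (hA e)
    exact ⟨S, Finset.mem_union_right _
      (mem_cleanUp.2 ⟨e, he, heS, fun S' hS' => not_lt.1 (hmin S' hS')⟩), heS⟩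

theorem card_cleanUp_le (A : ι → Finset E) (X : Finset ι) :
    (cleanUp A X).card ≤ ({e | ∀ S ∈ X, e ∉ A S} : Finset E).card := by
  refine Finset.card_le_card_of_forall_subsingleton
    (fun S e => e ∈ A S ∧ ∀ S', e ∈ A S' → S ≤ S') (fun S hS => ?_) fun e _ S hS T hT => ?_
  · simpa only [Finset.mem_filter_univ] using mem_cleanUp.1 hS
  · exact le_antisymm (hS.2.2 T hT.2.1) (hT.2.2 S hS.2.1)

theorem nonempty_of_mem_solution (hI : Regular I) {ω : Coin I → Bool} {S : ι}
    (hS : S ∈ solution I ω) : (I.A S).Nonempty := by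
  rw [solution_eq, Finset.mem_union, mem_cleanUp] at hS
  rcases hS with hS | ⟨e, _, he, _⟩
  exacts [(clean_afterStages hI (choices_proper ω) _ S hS).1, ⟨e, he⟩]

end CleanUp

section Agreement

variable {ι E : Type*} {I : Input ι E} {st st' : State ι E}

/-- The two states have the same free elements in the set `U`. -/
def State.AgreeOn (U : Finset E) (st st' : State ι E) : Prop :=
  ∀ e ∈ U, (e ∈ st.free ↔ e ∈ st'.free)

variable [DecidableEq E] {c : Choices ι E} {i : ℕ} {S : ι}

theorem State.AgreeOn.inter_eq (h : st.AgreeOn (I.A S) st') (hc : c.Proper I) :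
    c.B i S ∩ st.free = c.B i S ∩ st'.free := by
  ext e
  simp only [Finset.mem_inter]
  exact and_congr_right fun he => h e (hc i S he)

theorem State.AgreeOn.isLarge_iff (h : st.AgreeOn (I.A S) st') (hc : c.Proper I) :
    IsLarge I c i st S ↔ IsLarge I c i st' S :=
  isLarge_congr (h.inter_eq hc)

theorem mem_and_notMem_cover_and_isLarge_iff [Fintype ι] (hI : Regular I) (hc : c.Proper I)
    (h : st.AgreeOn (I.A S) st') (hst : st.Clean I) {G : ℕ → Finset ι} {k₀ R k : ℕ}
    (hG : Tracks I c i G st k₀ R) (hk : k₀ ≤ k) (hkR : k < k₀ + R) :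
    (S ∈ G k ∧ S ∉ st.cover ∧ IsLarge I c i st S) ↔ S ∈ c.F i k ∧ IsLarge I c i st' S := by
  obtain ⟨hsub, hlarge⟩ := hG k hk hkR
  rw [← h.isLarge_iff hc]
  exact ⟨fun hS => ⟨hsub hS.1, hS.2.2⟩, fun hS => ⟨hlarge S hS.1 hS.2,
    fun hcover => hS.2.not_disjoint hI hc (hst S hcover).2, hS.2⟩⟩

end Agreement

section Close

variable {ι E : Type*} [Fintype ι] [Fintype E] {I : Input ι E}

/-- The random states `X` and `Z` agree, at every single element and set, up to an error
probability `a`. There is no union bound over all elements or sets, so `a` can be chosen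
independently of their number. -/
structure Close (I : Input ι E) (X Z : (Coin I → Bool) → State ι E) (a : ℝ) : Prop where
  free : ∀ e, (coinMeasure I).real {ω | ¬ (e ∈ (X ω).free ↔ e ∈ (Z ω).free)} ≤ a
  cover : ∀ S, (coinMeasure I).real {ω | ¬ (S ∈ (X ω).cover ↔ S ∈ (Z ω).cover)} ≤ a

/-- The factor by which the error probability grows in a step in which the fate of an element
depends on the elements of the sets containing it. -/
noncomputable def growth (I : Input ι E) : ℝ := 2 + I.t + I.s * I.t

namespace Close

variable {X Z : (Coin I → Bool) → State ι E} {a : ℝ}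

theorem mono {b : ℝ} (h : Close I X Z a) (hab : a ≤ b) : Close I X Z b :=
  ⟨fun e => (h.free e).trans hab, fun S => (h.cover S).trans hab⟩

variable [DecidableEq E]

theorem measureReal_not_agreeOn_le (hI : Regular I) (h : Close I X Z a) (ha : 0 ≤ a) (S : ι) :
    (coinMeasure I).real {ω | ¬ (X ω).AgreeOn (I.A S) (Z ω)} ≤ I.s * a := by
  simp only [State.AgreeOn, not_forall, exists_prop]
  exact measureReal_exists_mem_le (hI.card_le S) ha fun e _ => h.free e

theorem measureReal_exists_bad_or_not_agreeOn_le (hI : Regular I) (h : Close I X Z a)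
    (ha : 0 ≤ a) {bad : ι → (Coin I → Bool) → Prop}
    (hbad : ∀ S, (coinMeasure I).real {ω | bad S ω} ≤ a) (e : E) :
    (coinMeasure I).real {ω | ∃ S ∈ ({S | e ∈ I.A S} : Finset ι),
      bad S ω ∨ ¬ (X ω).AgreeOn (I.A S) (Z ω)} ≤ I.t * (a + I.s * a) :=
  measureReal_exists_mem_le (hI.degree_le e) (by positivity) fun S _ =>
    (measureReal_le_add_of_imp_or fun _ => id).trans
      (add_le_add (hbad S) (h.measureReal_not_agreeOn_le hI ha S))

theorem pretend (hI : Regular I) (h : Close I X Z a) (ha : 0 ≤ a)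
    {Y : (Coin I → Bool) → Finset E} {bad : E → (Coin I → Bool) → Prop}
    (hbad : ∀ e, (coinMeasure I).real {ω | bad e ω} ≤ a)
    (hY : ∀ ω e, (∀ S, e ∈ I.A S → (X ω).AgreeOn (I.A S) (Z ω)) → e ∈ (Z ω).free →
      ¬ bad e ω → e ∉ Y ω) :
    Close I (fun ω => (X ω).pretend (Y ω)) Z (growth I * a) := by
  have hgrowth : a ≤ growth I * a := le_mul_of_one_le_left ha (by
    have : (0 : ℝ) ≤ I.t + I.s * I.t := by positivity
    rw [growth]
    linarith)
  refine ⟨fun e => ?_, fun S => (h.cover S).trans hgrowth⟩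
  have hlocal := h.measureReal_exists_bad_or_not_agreeOn_le hI ha (bad := fun _ _ => False)
    (fun _ => by simpa using ha) e
  calc (coinMeasure I).real {ω | ¬ (e ∈ ((X ω).pretend (Y ω)).free ↔ e ∈ (Z ω).free)}
      ≤ a + (I.t * (a + I.s * a) + a) := by
        refine (measureReal_le_add_of_imp_or fun ω hω => ?_).trans (add_le_add (h.free e)
          ((measureReal_le_add_of_imp_or fun _ => id).trans (add_le_add hlocal (hbad e))))
        contrapose! hω
        obtain ⟨he, hloc, hgood⟩ := hω
        simp only [State.pretend, Finset.mem_sdiff, he]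
        exact and_iff_left_of_imp fun hfree =>
          hY ω e (fun S hS => (hloc S (by simpa using hS)).2) hfree hgood
    _ = growth I * a := by
        rw [growth]
        ring

variable [LinearOrder ι]

theorem addSets (hI : Regular I) (h : Close I X Z a) (ha : 0 ≤ a)
    {Y Y' : (Coin I → Bool) → Finset ι} {bad : ι → (Coin I → Bool) → Prop}
    (hbad : ∀ S, (coinMeasure I).real {ω | bad S ω} ≤ a)
    (hY : ∀ ω S, (X ω).AgreeOn (I.A S) (Z ω) → ¬ bad S ω → (S ∈ Y ω ↔ S ∈ Y' ω)) :
    Close I (fun ω => (X ω).addSets I.A (Y ω)) (fun ω => (Z ω).addSets I.A (Y' ω))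
      (growth I * a) := by
  constructor
  · intro e
    calc _ ≤ a + I.t * (a + I.s * a) := by
          refine (measureReal_le_add_of_imp_or fun ω hω => ?_).trans (add_le_add (h.free e)
            (h.measureReal_exists_bad_or_not_agreeOn_le hI ha hbad e))
          contrapose! hω
          obtain ⟨he, hloc⟩ := hω
          rw [mem_addSets_free, mem_addSets_free, he]
          refine and_congr_right fun _ => forall_congr' fun S => ?_
          by_cases heS : e ∈ I.A S
          · obtain ⟨hgood, hagree⟩ := hloc S (by simpa using heS)
            rw [hY ω S hagree hgood]
          · simp only [heS, not_false_eq_true, implies_true]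
      _ ≤ growth I * a := by
          rw [growth]
          linarith
  · intro S
    have ht : I.s * a ≤ I.s * I.t * a := by
      have : (1 : ℝ) ≤ I.t := by exact_mod_cast one_le_two.trans hI.two_le_t
      gcongr
      exact le_mul_of_one_le_right (Nat.cast_nonneg _) this
    calc _ ≤ a + (a + I.s * a) := by
          refine (measureReal_le_add_of_imp_or fun ω hω => ?_).trans (add_le_add (h.cover S)
            ((measureReal_le_add_of_imp_or fun _ => id).trans
              (add_le_add (hbad S) (h.measureReal_not_agreeOn_le hI ha S))))
          contrapose! hω
          obtain ⟨hS, hgood, hagree⟩ := hω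
          simp only [State.addSets, Finset.mem_union, hS, hY ω S hagree hgood]
      _ ≤ growth I * a := by
          have : 0 ≤ I.t * a := by positivity
          rw [growth]
          linarith

end Close

end Close

section Coupling

variable {ι E : Type*} {I : Input ι E}

theorem one_le_growth : 1 ≤ growth I := by
  have : (0 : ℝ) ≤ I.t + I.s * I.t := by positivity
  rw [growth]
  linarith

theorem two_failProb_nonneg : 0 ≤ 2 * failProb I := mul_nonneg zero_le_two failProb_nonneg

theorem two_failProb_le_pow_mul {a : ℝ} (ha : 2 * failProb I ≤ a) (m : ℕ) :
    2 * failProb I ≤ growth I ^ m * a :=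
  ha.trans (le_mul_of_one_le_left (two_failProb_nonneg.trans ha) (one_le_pow₀ one_le_growth))

variable [Fintype ι] [LinearOrder ι] [Fintype E] [DecidableEq E] {i n : ℕ}
  {X : (Coin I → Bool) → State ι E} {a : ℝ}

theorem close_addSets_ideal (hI : Regular I) (hΛ : 2 ≤ I.Λ) (hi : i + 1 ∈ Finset.Icc 1 I.stages)
    (h : Close I X (fun ω => ideal I (choices I ω) i 0) a) (ha : 2 * failProb I ≤ a)
    {Y : (Coin I → Bool) → Finset ι}
    (hY : ∀ ω, ∀ S ∈ Y ω, I.Λ ^ 10 ≤ (((choices I ω).B (i + 1) S ∩ (X ω).free).card : ℝ)) :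
    Close I (fun ω => (X ω).addSets I.A (Y ω)) (fun ω => ideal I (choices I ω) i 0)
      (growth I * a) := by
  have hadd := h.addSets hI (two_failProb_nonneg.trans ha) (Y := Y) (Y' := fun _ => ∅)
    (fun S => (measureReal_le_card_sample_le hI hΛ hi S).trans ha) fun ω S hagree hgood =>
      ⟨fun hS => absurd (hagree.inter_eq (choices_proper ω) ▸ hY ω S hS) hgood,
        fun hS => absurd hS (Finset.notMem_empty S)⟩
  simpa only [State.addSets, Finset.union_empty, Finset.biUnion_empty, Finset.sdiff_empty]
    using hadd

theorem close_sparsifyStep (hI : Regular I) (hΛ : 2 ≤ I.Λ) {k m : ℕ}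
    (hi : i + 1 ∈ Finset.Icc 1 I.stages) (hk : k ∈ Finset.Icc 1 I.iterations)
    (hm : k = n + 1 + m) {thr : ℕ → ℝ} (hthr : I.Λ ^ 10 * 2 ^ m ≤ thr k)
    {x : (Coin I → Bool) → (ℕ → Finset ι) × State ι E}
    (h : Close I (fun ω => (x ω).2) (fun ω => ideal I (choices I ω) i n) a)
    (ha : 2 * failProb I ≤ a) (hG : ∀ ω, (x ω).1 k ⊆ (choices I ω).F (i + 1) k) :
    Close I (fun ω => (sparsifyStep I (choices I ω) (i + 1) thr (x ω) k).2)
      (fun ω => ideal I (choices I ω) i n) (growth I * a) := by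
  refine h.pretend hI (two_failProb_nonneg.trans ha) (fun e =>
    (measureReal_free_and_le_card_le hI hΛ hi hk hm e hthr).trans ha) ?_
  intro ω e hagree hfree hgood hpretends
  refine hgood ⟨hfree, (Finset.mem_filter.1 hpretends).2.trans (Nat.cast_le.2 ?_)⟩
  refine Finset.card_le_card fun S hS => ?_
  simp only [Finset.mem_filter, mem_largeSets] at hS ⊢
  obtain ⟨⟨hSG, hlarge⟩, heS⟩ := hS
  exact ⟨⟨((hagree S heS).isLarge_iff (choices_proper ω)).1 hlarge, heS⟩,
    (mem_choices_F hi hk).1 (hG ω hSG)⟩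

theorem close_sparsify (hI : Regular I) (hΛ : 2 ≤ I.Λ) {R : ℕ}
    (hi : i + 1 ∈ Finset.Icc 1 I.stages) (hR : n + R ≤ I.iterations) {thr : ℕ → ℝ}
    (hthr : ∀ m, I.Λ ^ 10 * 2 ^ m ≤ thr (n + 1 + m)) {G : (Coin I → Bool) → ℕ → Finset ι}
    (h : Close I X (fun ω => ideal I (choices I ω) i n) a) (ha : 2 * failProb I ≤ a)
    (hG : ∀ ω, Tracks I (choices I ω) (i + 1) (G ω) (X ω) (n + 1) R) {m : ℕ} (hm : m ≤ R) :
    Close I (fun ω => (sparsify I (choices I ω) (i + 1) thr (n + 1) m (G ω) (X ω)).2)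
      (fun ω => ideal I (choices I ω) i n) (growth I ^ m * a) := by
  induction m with
  | zero => rw [pow_zero, one_mul]; exact h
  | succ m ih =>
    rw [pow_succ', mul_assoc]
    simp only [sparsify_succ]
    refine close_sparsifyStep hI hΛ hi (Finset.mem_Icc.2 ⟨by omega, by omega⟩) rfl (hthr m)
      (ih (by omega)) (two_failProb_le_pow_mul ha m) fun ω => ?_
    exact (tracks_sparsify hI (hG ω) thr _ m _ (by omega) (by omega)).1

theorem close_baseCase (hI : Regular I) {R : ℕ} {G : (Coin I → Bool) → ℕ → Finset ι}
    (h : Close I X (fun ω => ideal I (choices I ω) i n) a) (ha : 0 ≤ a)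
    (hX : ∀ ω, (X ω).Clean I)
    (hG : ∀ ω, Tracks I (choices I ω) (i + 1) (G ω) (X ω) (n + 1) R) {m : ℕ} (hm : m ≤ R) :
    Close I (fun ω => baseCase I (choices I ω) (i + 1) (n + 1) m (G ω) (X ω))
      (fun ω => ideal I (choices I ω) i (n + m)) (growth I ^ m * a) := by
  induction m with
  | zero => rw [pow_zero, one_mul]; exact h
  | succ m ih =>
    have hpos : 0 ≤ growth I ^ m * a :=
      mul_nonneg (pow_nonneg (zero_le_one.trans one_le_growth) m) ha
    rw [pow_succ', mul_assoc, ← add_assoc]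
    simp only [baseCase_succ, ideal_succ, idealStep]
    refine (ih (by omega)).addSets hI hpos (bad := fun _ _ => False)
      (fun _ => by simpa using hpos) fun ω S hagree _ => ?_
    simp only [Finset.mem_filter]
    rw [Nat.add_right_comm n m 1]
    exact mem_and_notMem_cover_and_isLarge_iff hI (choices_proper ω) hagree
      (clean_baseCase hI (choices_proper ω) (hX ω) _ _ _ _)
      ((hG ω).mono hI (baseCase_free_subset ..) le_rfl le_rfl) (by omega) (by omega)

theorem sub_half_sq_add_sub_half_add_half_sq_le {R : ℕ} (hR : 1 < R) :
    (R - R / 2) ^ 2 + (R - R / 2) + (R / 2) ^ 2 ≤ R ^ 2 := by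
  have hhalf : 1 ≤ R / 2 := by omega
  obtain ⟨d, hd⟩ := Nat.exists_eq_add_of_le (Nat.div_le_self R 2)
  generalize R / 2 = r at hd hhalf
  subst hd
  rw [Nat.add_sub_cancel_left]
  nlinarith [Nat.mul_le_mul_right d hhalf]

theorem close_recSplit (hI : Regular I) (hΛ : 2 ≤ I.Λ) (hi : i + 1 ∈ Finset.Icc 1 I.stages)
    {R : ℕ} (hR : n + R ≤ I.iterations) {G : (Coin I → Bool) → ℕ → Finset ι}
    (h : Close I X (fun ω => ideal I (choices I ω) i n) a) (ha : 2 * failProb I ≤ a)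
    (hX : ∀ ω, (X ω).Clean I)
    (hG : ∀ ω, Tracks I (choices I ω) (i + 1) (G ω) (X ω) (n + 1) R) :
    Close I (fun ω => recSplit I (choices I ω) (i + 1) (n + 1) R (G ω) (X ω))
      (fun ω => ideal I (choices I ω) i (n + R)) (growth I ^ R ^ 2 * a) := by
  induction R using Nat.strong_induction_on generalizing n G X a with
  | _ R ih =>
    have ha₀ : 0 ≤ a := two_failProb_nonneg.trans ha
    simp only [recSplit.eq_1 I _ _ _ R]
    split_ifs with hbase
    · refine (close_baseCase hI h ha₀ hX hG le_rfl).mono ?_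
      gcongr
      exacts [one_le_growth, Nat.le_self_pow two_ne_zero R]
    · have hR₁ : 1 < R := not_le.1 (not_or.1 hbase).1
      have hfirst := ih (R / 2) (by omega) (by omega) h ha hX
        (fun ω => (hG ω).mono hI subset_rfl le_rfl (by omega))
      have hG' : ∀ ω, Tracks I (choices I ω) (i + 1) (G ω)
          (recSplit I (choices I ω) (i + 1) (n + 1) (R / 2) (G ω) (X ω)) (n + R / 2 + 1)
          (R - R / 2) := fun ω =>
        (hG ω).mono hI (recSplit_free_subset ..) (by omega) (by omega)
      have hsparse := close_sparsify hI hΛ hi (by omega)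
        (thr := fun k => I.Λ ^ 10 * 2 ^ (k - (n + R / 2 + 1)))
        (fun m => by rw [Nat.add_sub_cancel_left]) hfirst (two_failProb_le_pow_mul ha _) hG' le_rfl
      have hsecond := ih (R - R / 2) (by omega) (by omega) hsparse
        (two_failProb_le_pow_mul (two_failProb_le_pow_mul ha _) _)
        (fun ω => clean_sparsify (clean_recSplit hI (choices_proper ω) (hX ω) _ _ _ _) _ _ _ _ _)
        (fun ω => tracks_sparsify hI (hG' ω) _ _ _)
      rw [add_assoc n (R / 2) (R - R / 2), Nat.add_sub_of_le (Nat.div_le_self R 2)] at hsecond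
      rw [Nat.add_right_comm n 1]
      refine hsecond.mono ?_
      rw [← mul_assoc, ← mul_assoc, ← pow_add, ← pow_add]
      gcongr
      exacts [one_le_growth, sub_half_sq_add_sub_half_add_half_sq_le hR₁]

theorem close_stage (hI : Regular I) (hΛ : 2 ≤ I.Λ) (hi : i + 1 ∈ Finset.Icc 1 I.stages)
    (h : Close I X (fun ω => ideal I (choices I ω) i 0) a) (ha : 2 * failProb I ≤ a)
    (hX : ∀ ω, (X ω).Clean I) :
    Close I (fun ω => stage I (choices I ω) (X ω) (i + 1))
      (fun ω => ideal I (choices I ω) (i + 1) 0)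
      (growth I ^ (I.iterations ^ 2 + I.iterations + 1) * a) := by
  classical
  let Y : (Coin I → Bool) → Finset ι := fun ω =>
    {S | I.Λ ^ 10 ≤ (((choices I ω).B (i + 1) S ∩ (X ω).free).card : ℝ)}
  have hY : ∀ ω, ∀ S ∈ Y ω, I.Λ ^ 10 ≤ (((choices I ω).B (i + 1) S ∩ (X ω).free).card : ℝ) :=
    fun ω S hS => (Finset.mem_filter.1 hS).2
  have hcut := close_addSets_ideal hI hΛ hi h ha hY
  have hcut_error : 2 * failProb I ≤ growth I * a := by
    simpa only [pow_one] using two_failProb_le_pow_mul ha 1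
  have htracks : ∀ ω, Tracks I (choices I ω) (i + 1) ((choices I ω).F (i + 1))
      ((X ω).addSets I.A (Y ω)) (0 + 1) I.iterations := fun ω k _ _ =>
    ⟨subset_rfl, fun S hS _ => hS⟩
  have hsparse := close_sparsify hI hΛ hi (zero_add _).le (thr := fun k => I.Λ ^ 10 * 2 ^ k)
    (fun m => by
      have := hI.Λ_pos
      gcongr
      exacts [one_le_two, by omega]) hcut hcut_error htracks le_rfl
  have hsplit := close_recSplit hI hΛ hi (zero_add _).le hsparse
    (two_failProb_le_pow_mul hcut_error _) (fun ω => clean_sparsify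
      (clean_addSets_of_le_card hI (choices_proper ω) (hX ω) (hY ω)) _ _ _ _ _)
    fun ω => tracks_sparsify hI (htracks ω) _ _ _
  rw [zero_add, zero_add, ← mul_assoc, ← mul_assoc, ← pow_add, ← pow_succ] at hsplit
  exact hsplit

theorem close_afterStages (hI : Regular I) (hΛ : 2 ≤ I.Λ) {i : ℕ} (hi : i ≤ I.stages) :
    Close I (fun ω => afterStages I (choices I ω) i) (fun ω => ideal I (choices I ω) i 0)
      (growth I ^ ((I.iterations ^ 2 + I.iterations + 1) * i) * (2 * failProb I)) := by
  induction i with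
  | zero =>
    rw [mul_zero, pow_zero, one_mul]
    constructor <;> intro x <;>
      simpa [afterStages, ideal, idealStage, idealStart] using two_failProb_nonneg
  | succ i ih =>
    simp only [afterStages_succ]
    rw [mul_add_one, add_comm (_ * i), pow_add, mul_assoc]
    exact close_stage hI hΛ (Finset.mem_Icc.2 ⟨by omega, hi⟩) (ih (by omega))
      (two_failProb_le_pow_mul le_rfl _) fun ω => clean_afterStages hI (choices_proper ω) i

end Coupling

section Deviation

variable {ι E : Type*} {I : Input ι E}

/-- A bound for the probability that, at a given element or set, the final state of the algorithm
differs from that of the idealised process. -/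
noncomputable def deviation (I : Input ι E) : ℝ :=
  growth I ^ ((I.iterations ^ 2 + I.iterations + 1) * I.stages) * (2 * failProb I)

theorem deviation_nonneg : 0 ≤ deviation I :=
  mul_nonneg (pow_nonneg (zero_le_one.trans one_le_growth) _) two_failProb_nonneg

theorem s_div_two_pow_stages_le_one : (I.s : ℝ) / 2 ^ I.stages ≤ 1 := by
  rw [div_le_one (by positivity)]
  exact_mod_cast Nat.le_pow_clog (by norm_num) I.s

variable [Fintype ι] [DecidableEq E]

theorem stages_pos (hI : Regular I) : 0 < I.stages :=
  Nat.clog_pos (by norm_num) hI.two_le_s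

theorem sampleProb_stages (hI : Regular I) : I.sampleProb I.stages = 1 := by
  have hs := hI.s_pos
  refine min_eq_left (one_le_mul_of_one_le_of_one_le (one_le_pow₀ hI.one_le_Λ) ?_)
  rw [one_le_div hs, ← div_le_one (by positivity)]
  exact s_div_two_pow_stages_le_one

variable [LinearOrder ι] [Fintype E]

-- In the last iteration of the last stage all coins are certain and the threshold is at most one.
theorem freeProb_stages (hI : Regular I) {e : E} (he : ∃ S, e ∈ I.A S) :
    freeProb I I.stages 0 e = 0 := by
  obtain ⟨S, heS⟩ := he
  obtain ⟨i, hi⟩ := Nat.exists_eq_add_one.2 (stages_pos hI)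
  obtain ⟨L, hL⟩ := Nat.exists_eq_add_one.2 (iterations_pos hI)
  have hi' : i + 1 ∈ Finset.Icc 1 I.stages := Finset.mem_Icc.2 ⟨by omega, hi.ge⟩
  have hk : L + 1 ∈ Finset.Icc 1 I.iterations := Finset.mem_Icc.2 ⟨by omega, hL.ge⟩
  have hp : I.sampleProb (i + 1) = 1 := by
    rw [← hi]
    exact sampleProb_stages hI
  have hq : I.familyProb (L + 1) = 1 := by
    rw [← hL]
    exact familyProb_iterations hI
  have hfamily := measureReal_eq_false_eq_zero hI
    (show coinProb I (familyCoin hi' hk S) = 1 from hq)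
  have hsample := measureReal_eq_false_eq_zero hI (show coinProb I (sampleCoin hi' S e) = 1 from hp)
  refine le_antisymm ?_ (freeProb_nonneg _ _ e)
  refine (measureReal_le_add_of_imp_or fun ω hω => ?_).trans
    ((add_le_add hfamily.le hsample.le).trans_eq (zero_add 0))
  contrapose! hω
  obtain ⟨hF, hB⟩ := hω
  rw [hi, ← ideal_iterations, hL, mem_ideal_free_succ]
  rintro ⟨hfree, hadded⟩
  refine hadded S ((mem_choices_F hi' hk).2 (by simpa using hF)) ?_ heS
  rw [isLarge_iff hI, hp, mul_one]
  have hmem : e ∈ (choices I ω).B (i + 1) S ∩ (ideal I (choices I ω) i L).free :=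
    Finset.mem_inter.2 ⟨(mem_choices_B hi').2 ⟨heS, by simpa using hB⟩, hfree⟩
  have hscale : (I.s : ℝ) / 2 ^ (i + 1) ≤ 1 := by
    rw [← hi]
    exact s_div_two_pow_stages_le_one
  exact hscale.trans (Nat.one_le_cast.2 (Finset.card_pos.2 ⟨e, hmem⟩))

theorem close_solution (hI : Regular I) (hΛ : 2 ≤ I.Λ) :
    Close I (fun ω => afterStages I (choices I ω) I.stages)
      (fun ω => ideal I (choices I ω) I.stages 0) (deviation I) :=
  close_afterStages hI hΛ le_rfl

theorem measureReal_uncovered_le (hI : Regular I) (hΛ : 2 ≤ I.Λ) {e : E} (he : ∃ S, e ∈ I.A S) :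
    (coinMeasure I).real {ω | ∀ S ∈ (afterStages I (choices I ω) I.stages).cover, e ∉ I.A S} ≤
      I.t * deviation I := by
  have hdiffer := measureReal_exists_mem_le (hI.degree_le e) deviation_nonneg
    fun S _ => (close_solution hI hΛ).cover S
  refine (measureReal_le_add_of_imp_or fun ω hω => ?_).trans
    ((add_le_add (freeProb_stages hI he).le hdiffer).trans_eq (zero_add _))
  contrapose! hω
  obtain ⟨hfree, hagree⟩ := hω
  rw [mem_ideal_free_iff] at hfree
  push Not at hfree
  obtain ⟨S, hS, heS⟩ := hfree
  exact ⟨S, (hagree S (by simpa using heS)).2 hS, heS⟩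

open scoped Classical in
theorem card_solution_le (hI : Regular I) (ω : Coin I → Bool) :
    (solution I ω).card ≤ (ideal I (choices I ω) I.stages 0).cover.card +
      (({S | (I.A S).Nonempty} : Finset ι).filter fun S =>
        ¬ (S ∈ (afterStages I (choices I ω) I.stages).cover ↔
          S ∈ (ideal I (choices I ω) I.stages 0).cover)).card +
      ({e | ∀ S ∈ (afterStages I (choices I ω) I.stages).cover, e ∉ I.A S} : Finset E).card := by
  rw [solution_eq]
  refine (Finset.card_union_le _ _).trans (add_le_add ?_ ?_)
  · refine (Finset.card_le_card fun S hS => ?_).trans (Finset.card_union_le _ _)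
    have hne := (clean_afterStages hI (choices_proper ω) _ S hS).1
    simp only [Finset.mem_union, Finset.mem_filter, Finset.mem_univ, true_and]
    tauto
  · convert card_cleanUp_le I.A _

theorem expectedSize_le_ideal (hI : Regular I) (hΛ : 2 ≤ I.Λ) (hcov : ∀ e, ∃ S, e ∈ I.A S) :
    expectedSize I ≤
      ∫ ω, ((ideal I (choices I ω) I.stages 0).cover.card : ℝ) ∂coinMeasure I +
        2 * (I.t * Fintype.card E * deviation I) := by
  classical
  have hdiffer : ∑ S with (I.A S).Nonempty, (coinMeasure I).real
        {ω | ¬ (S ∈ (afterStages I (choices I ω) I.stages).cover ↔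
          S ∈ (ideal I (choices I ω) I.stages 0).cover)} ≤
      I.t * Fintype.card E * deviation I :=
    (Finset.sum_le_card_nsmul _ _ _ fun S _ => (close_solution hI hΛ).cover S).trans <| by
      rw [nsmul_eq_mul]
      exact mul_le_mul_of_nonneg_right (card_nonempty_le hI) deviation_nonneg
  have huncovered : ∑ e, (coinMeasure I).real
        {ω | ∀ S ∈ (afterStages I (choices I ω) I.stages).cover, e ∉ I.A S} ≤
      I.t * Fintype.card E * deviation I :=
    (Finset.sum_le_card_nsmul _ _ _ fun e _ => measureReal_uncovered_le hI hΛ (hcov e)).trans_eq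
      (by rw [nsmul_eq_mul, Finset.card_univ]; ring)
  simp only [← integral_ite_one_zero] at hdiffer huncovered
  rw [← integral_finsetSum _ fun _ _ => .of_finite] at hdiffer huncovered
  have hcard : expectedSize I ≤ _ :=
    integral_mono .of_finite .of_finite fun ω => Nat.cast_le.2 (card_solution_le hI ω)
  simp only [Nat.cast_add, ← Finset.sum_boole] at hcard
  rw [integral_add .of_finite .of_finite, integral_add .of_finite .of_finite] at hcard
  linarith

end Deviation

section Numerics

theorem one_le_logb_two {n : ℕ} (hn : 2 ≤ n) : (1 : ℝ) ≤ Real.logb 2 n := by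
  rw [Real.le_logb_iff_rpow_le (by norm_num) (by positivity), Real.rpow_one]
  exact_mod_cast hn

theorem one_le_logb_two_mul_div_two {s t : ℕ} (hs : 2 ≤ s) (ht : 2 ≤ t) :
    (1 : ℝ) ≤ Real.logb 2 (s * t) / 2 := by
  have hs_log := one_le_logb_two hs
  have ht_log := one_le_logb_two ht
  rw [Real.logb_mul (by positivity) (by positivity)]
  linarith

theorem clog_le_two_mul_logb {n : ℕ} (hn : 2 ≤ n) : (Nat.clog 2 n : ℝ) ≤ 2 * Real.logb 2 n := by
  have hlog := one_le_logb_two hn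
  have hceil := Nat.ceil_lt_add_one (zero_le_one.trans hlog)
  rw [← Nat.cast_ofNat (R := ℝ) (n := 2), Real.natCeil_logb_natCast, Nat.cast_ofNat] at hceil
  linarith

theorem four_rpow_le_exp {x : ℝ} (hx : 0 ≤ x) : (4 : ℝ) ^ x ≤ Real.exp (2 * x) := by
  have hfour : (4 : ℝ) ≤ Real.exp 2 := by
    have hsq : Real.exp 2 = Real.exp 1 * Real.exp 1 := by
      rw [← Real.exp_add, one_add_one_eq_two]
    nlinarith [Real.exp_one_gt_d9]
  rw [Real.exp_mul]
  exact Real.rpow_le_rpow (by norm_num) hfour hx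

variable {ι E : Type*} [Fintype ι] [DecidableEq E] {I : Input ι E}

theorem s_mul_t_le_rpow (hI : Regular I) (h : Real.logb 2 (I.s * I.t) / 2 ≤ I.Λ) :
    (I.s : ℝ) * I.t ≤ 4 ^ I.Λ := by
  have hs := hI.s_pos
  have ht := hI.t_pos
  have hlog : Real.logb 2 (I.s * I.t) ≤ 2 * I.Λ := by linarith
  rw [Real.logb_le_iff_le_rpow (by norm_num) (by positivity), Real.rpow_mul (by norm_num)] at hlog
  norm_num at hlog
  exact hlog

theorem s_mul_t_le_exp (hI : Regular I) (h : Real.logb 2 (I.s * I.t) / 2 ≤ I.Λ) :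
    (I.s : ℝ) * I.t ≤ Real.exp (2 * I.Λ) :=
  (s_mul_t_le_rpow hI h).trans (four_rpow_le_exp hI.Λ_pos.le)

theorem stages_add_iterations_le (hI : Regular I) (h : Real.logb 2 (I.s * I.t) / 2 ≤ I.Λ) :
    (I.stages + I.iterations : ℝ) ≤ 4 * I.Λ := by
  have hstages : (I.stages : ℝ) ≤ _ := clog_le_two_mul_logb hI.two_le_s
  have hiterations : (I.iterations : ℝ) ≤ _ := clog_le_two_mul_logb hI.two_le_t
  rw [Real.logb_mul hI.s_pos.ne' hI.t_pos.ne'] at h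
  linarith

theorem growth_le_exp (hI : Regular I) (h : Real.logb 2 (I.s * I.t) / 2 ≤ I.Λ) (hΛ : 2 ≤ I.Λ) :
    growth I ≤ Real.exp (3 * I.Λ) := by
  have hs : (2 : ℝ) ≤ I.s := Nat.ofNat_le_cast.2 hI.two_le_s
  have ht : (2 : ℝ) ≤ I.t := Nat.ofNat_le_cast.2 hI.two_le_t
  calc growth I ≤ 2 * (I.s * I.t) := by
        rw [growth]
        nlinarith
    _ ≤ Real.exp I.Λ * Real.exp (2 * I.Λ) := by
        gcongr
        · linarith [Real.two_mul_le_exp (x := I.Λ)]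
        · exact s_mul_t_le_exp hI h
    _ = Real.exp (3 * I.Λ) := by rw [← Real.exp_add]; ring_nf

theorem growth_pow_le_exp (hI : Regular I) (h : Real.logb 2 (I.s * I.t) / 2 ≤ I.Λ)
    (hΛ : 2 ≤ I.Λ) :
    growth I ^ ((I.iterations ^ 2 + I.iterations + 1) * I.stages) ≤ Real.exp (252 * I.Λ ^ 4) := by
  have hsum := stages_add_iterations_le hI h
  have hstages : (I.stages : ℝ) ≤ 4 * I.Λ := by linarith [I.iterations.cast_nonneg (α := ℝ)]
  have hiterations : (I.iterations : ℝ) ≤ 4 * I.Λ := by linarith [I.stages.cast_nonneg (α := ℝ)]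
  have hsteps : (I.iterations : ℝ) ^ 2 + I.iterations + 1 ≤ 21 * I.Λ ^ 2 :=
    calc (I.iterations : ℝ) ^ 2 + I.iterations + 1 ≤ (4 * I.Λ) ^ 2 + 4 * I.Λ + 1 := by gcongr
      _ ≤ 21 * I.Λ ^ 2 := by nlinarith
  calc growth I ^ ((I.iterations ^ 2 + I.iterations + 1) * I.stages)
      ≤ Real.exp (3 * I.Λ) ^ ((I.iterations ^ 2 + I.iterations + 1) * I.stages) :=
        pow_le_pow_left₀ (zero_le_one.trans one_le_growth) (growth_le_exp hI h hΛ) _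
    _ = Real.exp (((I.iterations : ℝ) ^ 2 + I.iterations + 1) * I.stages * (3 * I.Λ)) := by
        rw [← Real.exp_nat_mul]
        push_cast
        rfl
    _ ≤ Real.exp (21 * I.Λ ^ 2 * (4 * I.Λ) * (3 * I.Λ)) := by gcongr
    _ = Real.exp (252 * I.Λ ^ 4) := by ring_nf

theorem mul_pow_four_le_pow_five {x : ℝ} (hx : 600 ≤ x) : 600 * x ^ 4 ≤ x ^ 5 := by
  rw [pow_succ' x 4]
  gcongr

theorem le_pow_four_of_six_hundred_le {x : ℝ} (hx : 600 ≤ x) : x ≤ x ^ 4 :=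
  le_self_pow₀ (by linarith) (by norm_num)

theorem s_mul_t_mul_deviation_le (hI : Regular I) (h : Real.logb 2 (I.s * I.t) / 2 ≤ I.Λ)
    (hΛ : 600 ≤ I.Λ) : 2 * (I.s * I.t * deviation I) ≤ 1 := by
  have hfail := failProb_nonneg (I := I)
  calc 2 * (I.s * I.t * deviation I)
      = 4 * (I.s * I.t) * growth I ^ ((I.iterations ^ 2 + I.iterations + 1) * I.stages) *
          failProb I := by rw [deviation]; ring
    _ ≤ Real.exp I.Λ * Real.exp (2 * I.Λ) * Real.exp (252 * I.Λ ^ 4) * failProb I := by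
        gcongr
        · exact pow_nonneg (zero_le_one.trans one_le_growth) _
        · linarith [Real.two_mul_le_exp (x := I.Λ)]
        · exact s_mul_t_le_exp hI h
        · exact growth_pow_le_exp hI h (by linarith)
    _ ≤ 1 := by
        rw [failProb, ← Real.exp_add, ← Real.exp_add, ← Real.exp_add, Real.exp_le_one_iff]
        linarith [mul_pow_four_le_pow_five hΛ, le_pow_four_of_six_hundred_le hΛ]

theorem iterations_mul_failProb_le (hI : Regular I) (h : Real.logb 2 (I.s * I.t) / 2 ≤ I.Λ)
    (hΛ : 600 ≤ I.Λ) : I.iterations * (I.s * I.t * failProb I) ≤ 1 := by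
  have hiterations : (I.iterations : ℝ) ≤ 4 * I.Λ := by
    linarith [stages_add_iterations_le hI h, I.stages.cast_nonneg (α := ℝ)]
  calc I.iterations * (I.s * I.t * failProb I)
      ≤ Real.exp (4 * I.Λ) * (Real.exp (2 * I.Λ) * failProb I) := by
        have hfail := failProb_nonneg (I := I)
        gcongr
        · linarith [Real.two_mul_le_exp (x := 4 * I.Λ)]
        · exact s_mul_t_le_exp hI h
    _ ≤ 1 := by
        rw [failProb, ← Real.exp_add, ← Real.exp_add, Real.exp_le_one_iff]
        linarith [mul_pow_four_le_pow_five hΛ, le_pow_four_of_six_hundred_le hΛ]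

theorem two_pow_stages_mul_failProb_le (hI : Regular I)
    (h : Real.logb 2 (I.s * I.t) / 2 ≤ I.Λ) (hΛ : 600 ≤ I.Λ) :
    2 ^ I.stages * failProb I ≤ 1 := by
  have hstages : (I.stages : ℝ) ≤ 4 * I.Λ := by
    linarith [stages_add_iterations_le hI h, I.iterations.cast_nonneg (α := ℝ)]
  calc 2 ^ I.stages * failProb I ≤ Real.exp 1 ^ I.stages * failProb I := by
        have hfail := failProb_nonneg (I := I)
        gcongr
        linarith [Real.exp_one_gt_d9]
    _ ≤ 1 := by
        rw [failProb, ← Real.exp_nat_mul, ← Real.exp_add, Real.exp_le_one_iff]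
        linarith [mul_pow_four_le_pow_five hΛ, le_pow_four_of_six_hundred_le hΛ]

end Numerics

section Conclusion

variable {ι E : Type*} [Fintype ι] [Fintype E] [DecidableEq E] {I : Input ι E} {x : ι → ℝ}

theorem mul_card_mul_le_sum (hI : Regular I) (hx : IsFractionalCover I.A x) {a b : ℝ}
    (ha : 0 ≤ a) (hb : 0 ≤ b) (h : a * (I.s * I.t * b) ≤ 1) :
    a * (I.t * Fintype.card E * b) ≤ ∑ S, x S := by
  have hX : 0 ≤ ∑ S, x S := Finset.sum_nonneg fun S _ => hx.1 S
  calc a * (I.t * Fintype.card E * b) ≤ a * (I.t * (I.s * ∑ S, x S) * b) := by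
        gcongr
        exact card_le_mul_sum hI hx
    _ = a * (I.s * I.t * b) * ∑ S, x S := by ring
    _ ≤ ∑ S, x S := mul_le_of_le_one_left hX h

variable [LinearOrder ι]

theorem expectedSize_le_of_six_hundred_le (hI : Regular I) (hcov : ∀ e, ∃ S, e ∈ I.A S)
    (h : Real.logb 2 (I.s * I.t) / 2 ≤ I.Λ) (hΛ : 600 ≤ I.Λ) (hx : IsFractionalCover I.A x) :
    expectedSize I ≤ 292 * Real.logb 2 I.s * ∑ S, x S := by
  have hX : 0 ≤ ∑ S, x S := Finset.sum_nonneg fun S _ => hx.1 S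
  have hstages : (1 : ℝ) ≤ I.stages := Nat.one_le_cast.2 (stages_pos hI)
  have hdeviation := mul_card_mul_le_sum hI hx zero_le_two deviation_nonneg
    (s_mul_t_mul_deviation_le hI h hΛ)
  have hfail := mul_card_mul_le_sum hI hx I.iterations.cast_nonneg failProb_nonneg
    (iterations_mul_failProb_le hI h hΛ)
  have hcoeff : 128 + 16 * 2 ^ I.stages * failProb I ≤ 144 := by
    linarith [two_pow_stages_mul_failProb_le hI h hΛ]
  calc expectedSize I ≤ _ := expectedSize_le_ideal hI (by linarith) hcov
    _ ≤ I.stages * (∑ S, x S + 144 * ∑ S, x S) + ∑ S, x S := by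
        refine add_le_add ((integral_card_ideal_cover_le hI hx).trans ?_) hdeviation
        gcongr
    _ ≤ I.stages * (∑ S, x S + 144 * ∑ S, x S) + I.stages * ∑ S, x S := by
        gcongr
        exact le_mul_of_one_le_left hX hstages
    _ = 146 * I.stages * ∑ S, x S := by ring
    _ ≤ 146 * (2 * Real.logb 2 I.s) * ∑ S, x S := by
        gcongr
        exact clog_le_two_mul_logb hI.two_le_s
    _ = 292 * Real.logb 2 I.s * ∑ S, x S := by ring

theorem expectedSize_le_mul_card (hI : Regular I) : expectedSize I ≤ I.t * Fintype.card E := by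
  have hcard (ω : Coin I → Bool) : ((solution I ω).card : ℝ) ≤ I.t * Fintype.card E := by
    refine le_trans ?_ (card_nonempty_le hI)
    gcongr
    exact fun S hS => (Finset.mem_filter_univ _).2 (nonempty_of_mem_solution hI hS)
  simpa [expectedSize] using integral_mono (μ := coinMeasure I) .of_finite .of_finite hcard

theorem expectedSize_le_of_le_six_hundred (hI : Regular I)
    (h : Real.logb 2 (I.s * I.t) / 2 ≤ I.Λ) (hΛ : I.Λ ≤ 600) (hx : IsFractionalCover I.A x) :
    expectedSize I ≤ (4 : ℝ) ^ (600 : ℝ) * Real.logb 2 I.s * ∑ S, x S := by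
  have hX : 0 ≤ ∑ S, x S := Finset.sum_nonneg fun S _ => hx.1 S
  calc expectedSize I ≤ I.t * Fintype.card E := expectedSize_le_mul_card hI
    _ ≤ I.t * (I.s * ∑ S, x S) := by
        gcongr
        exact card_le_mul_sum hI hx
    _ = I.s * I.t * 1 * ∑ S, x S := by ring
    _ ≤ (4 : ℝ) ^ (600 : ℝ) * Real.logb 2 I.s * ∑ S, x S := by
        gcongr
        · exact (s_mul_t_le_rpow hI h).trans
            (Real.rpow_le_rpow_of_exponent_le (by norm_num) hΛ)
        · exact one_le_logb_two hI.two_le_s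

theorem expectedSize_le (hI : Regular I) (hcov : ∀ e, ∃ S, e ∈ I.A S)
    (h : Real.logb 2 (I.s * I.t) / 2 ≤ I.Λ) (hx : IsFractionalCover I.A x) :
    expectedSize I ≤ (292 + (4 : ℝ) ^ (600 : ℝ)) * Real.logb 2 I.s * ∑ S, x S := by
  have hX : 0 ≤ ∑ S, x S := Finset.sum_nonneg fun S _ => hx.1 S
  have hlog := zero_le_one.trans (one_le_logb_two hI.two_le_s)
  rcases le_total I.Λ 600 with hΛ | hΛ
  · refine (expectedSize_le_of_le_six_hundred hI h hΛ hx).trans ?_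
    gcongr
    exact le_add_of_nonneg_left (by norm_num)
  · refine (expectedSize_le_of_six_hundred_le hI hcov h hΛ hx).trans ?_
    gcongr
    exact le_add_of_nonneg_right (by positivity)

end Conclusion

section FractionalOptimum

variable {ι E : Type*} [Fintype ι] [DecidableEq E]

theorem le_mul_opt {A : ι → Finset E} (hcov : ∀ e, ∃ S, e ∈ A S) {v c : ℝ} (hc : 0 < c)
    (h : ∀ x, IsFractionalCover A x → v ≤ c * ∑ S, x S) : v ≤ c * opt A := by
  rw [← div_le_iff₀' hc]
  refine le_csInf ⟨_, fun _ => 1, ⟨fun _ => zero_le_one, fun e => ?_⟩, rfl⟩ ?_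
  · obtain ⟨S, hS⟩ := hcov e
    rw [Finset.sum_const, nsmul_eq_mul, mul_one]
    exact Nat.one_le_cast.2 (Finset.card_pos.2 ⟨S, (Finset.mem_filter_univ S).2 hS⟩)
  · rintro _ ⟨x, hx, rfl⟩
    exact (div_le_iff₀' hc).2 (h x hx)

end FractionalOptimum

end RepeatedSparsification

theorem mainTheorem6 :
    ∃ C : ℝ, 0 < C ∧
      ∀ (ι : Type*) (E : Type*) [Fintype ι] [LinearOrder ι] [Fintype E] [DecidableEq E]
        (A : ι → Finset E) (s t : ℕ) (Λ : ℝ),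
        2 ≤ s → 2 ≤ t →
        (∀ S, (A S).card ≤ s) →
        (∀ e, RepeatedSparsification.elemDegree A Finset.univ e ≤ t) →
        (∀ e, ∃ S, e ∈ A S) →
        Real.logb 2 (s * t) / 2 ≤ Λ →
        (∀ ω, RepeatedSparsification.IsSetCover A
          (RepeatedSparsification.solution ⟨A, s, t, Λ⟩ ω)) ∧
        RepeatedSparsification.expectedSize ⟨A, s, t, Λ⟩ ≤
          C * Real.logb 2 s * RepeatedSparsification.opt A := by
  refine ⟨292 + (4 : ℝ) ^ (600 : ℝ), by positivity, ?_⟩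
  intro ι E _ _ _ _ A s t Λ hs ht hA hdeg hcov hΛ
  have hlog := RepeatedSparsification.one_le_logb_two hs
  have hI : RepeatedSparsification.Regular (⟨A, s, t, Λ⟩ : RepeatedSparsification.Input ι E) :=
    ⟨hs, ht, hA, hdeg, (RepeatedSparsification.one_le_logb_two_mul_div_two hs ht).trans hΛ⟩
  refine ⟨fun ω => RepeatedSparsification.isSetCover_union_cleanUp hcov _, ?_⟩
  exact RepeatedSparsification.le_mul_opt hcov (by positivity) fun x hx =>
    RepeatedSparsification.expectedSize_le hI hcov hΛ hx
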